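/- Let $\eta$ be Dedekind's function and $\zeta_n=\exp(2\pi i/n)$. Let $p_1,p_2$ be primes, $N=p_1p_2$, $s=24/\gcd(24,(p_1-1)(p_2-1))$, $e\neq s$ a positive divisor of $s$, and $\delta=s/e$; assume $N\equiv 1\bmod\delta$. Put $\phi=\zeta_{24}^{(p_1-1)(p_2-1)}$ and $\chi=\phi^{-e}$. For $z$ in the upper half-plane let $$\mathfrak w(z)=\frac{\eta(z/p_1)\,\eta(z/p_2)}{\eta(z)\,\eta(z/N)},\qquad A_\nu(z)=\mathfrak w(z+\nu)\ (0\le\nu<N),\qquad B(z)=\frac{\eta(p_1z)\,\eta(p_2z)}{\eta(z)\,\eta(Nz)}.$$ *If $p_1\ne p_2$*, let $u,v$ be any integers with $up_1+vp_2=1$ and let, for $0\le\nu<p_2$, $$C_{2,\nu}(z)=\phi^{\theta_2(\nu)}\,\varepsilon_2\,\frac{\eta(p_1(z+\nu))\,\eta((z+\nu)/p_2)}{\eta(z+\nu)\,\eta(p_1(z+\nu)/p_2)},$$ where $\varepsilon_2=\left(\frac{p_1}{p_2}\right)$ (Legendre symbol) if $p_2\ne2$ and $\varepsilon_2=1$ if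 $p_2=2$. If $p_2\neq 2$, then $\theta_2(0)=uv(p_2+1)+u-1$, and for $\nu>0$, $\theta_2(\nu)=\mu((p_2+1)v_2+1)+\nu$ with $1\le\mu<p_2$, $\mu\equiv-(\nu p_1)^{-1}\bmod p_2$ and $v_2=(1+p_1\mu\nu)/p_2$. If $p_2=2$, then $\theta_2(0)=(3u+2)(u-1)/2$ and $\theta_2(1)=3p_1+2$. Define $C_{1,\nu}$ $(0\le\nu<p_1)$, $\theta_1$, $\varepsilon_1$ in the same way after exchanging $(p_1,u)$ and $(p_2,v)$. *If $p_1=p_2=p$*, let, for $1\le\nu<p$, $$C_\nu(z)=\sqrt p\,\varepsilon(\nu)\,\zeta_{24}^{\theta(\nu)}\,\frac{\eta(pz)^2}{\eta(z)\,\eta(z+\nu/p)},$$ where, with $1\le\mu<p$, $\mu\equiv-\nu^{-1}\bmod p$ and $v=(1+\mu\nu)/p$, one has $\varepsilon(\nu)=\left(\frac{-\nu}{p}\right)$ and $\theta(\nu)=p\nu(1-\mu^2)+(-3p+2+v)\mu-3+3p$ if $p$ is odd, and $\varepsilon(\nu)=1$, $\theta(\nu)=0$ if $p=2$. Then $\delta\in\{2,3,6\}$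 and $\chi$ is a primitive $\delta$-th root of unity. Let $\alpha_0=1,0,3$ for $\delta=2,3,6$ respectively; then $\chi^{\alpha_0}=(-1)^{\delta+1}=\chi^{-\alpha_0}=\chi^{-3}$. Define $$A_\nu'=\chi^{\alpha_0-\nu}A_\nu^e,\quad B'=B^e,\quad C_{1,\nu}'=\chi^{\theta_1(\nu)-\nu}C_{1,\nu}^e,\quad C_{2,\nu}'=\chi^{\theta_2(\nu)-\nu}C_{2,\nu}^e,\quad C_\nu'=\chi^{\mu}C_\nu^e .$$ For every integer $k$ put $$\mathcal S_k={B'}^k+\sum_{\nu=0}^{N-1}{A_\nu'}^k+\begin{cases}\displaystyle\sum_{\nu=0}^{p_1-1}{C_{1,\nu}'}^k+\sum_{\nu=0}^{p_2-1}{C_{2,\nu}'}^k&\text{if }p_1\ne p_2,\\[2mm]\displaystyle\sum_{\nu=1}^{p-1}{C_\nu'}^k&\text{if }p_1=p_2=p.\end{cases}$$ Then, for every integer $k$ and every $z$ in the upper half-plane, $$\mathcal S_k(z+1)=\chi^k\,\mathcal S_k(z),\qquad \mathcal S_k(-1/z)=\chi^{\alpha_0k}\,\mathcal S_k(z).$$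 -/

import Mathlib

/-! The conjugates of double eta-quotients and their twisted powers.
All functions of `z` below are meant for `z` in the upper half-plane; `ModularForm.eta` is
Dedekind's function. -/

namespace DoubleEta

/-- The root of unity `ζ_n = exp (2 π i / n)`. -/
noncomputable def zeta (n : ℕ) : ℂ := Complex.exp (2 * Real.pi * Complex.I / n)

/-- `s = 24 / gcd (24, (p₁ - 1) (p₂ - 1))`. -/
def s (p₁ p₂ : ℕ) : ℕ := 24 / Nat.gcd 24 ((p₁ - 1) * (p₂ - 1))

/-- `φ = ζ₂₄ ^ ((p₁ - 1) (p₂ - 1))`. -/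
noncomputable def phi (p₁ p₂ : ℕ) : ℂ := zeta 24 ^ ((p₁ - 1) * (p₂ - 1))

/-- `χ = φ ^ (-e)`. -/
noncomputable def chi (p₁ p₂ e : ℕ) : ℂ := phi p₁ p₂ ^ (-(e : ℤ))

/-- `α₀ = 1, 0, 3` for `δ = 2, 3, 6` respectively; only these three values of `δ` matter. -/
def alpha0 (δ : ℕ) : ℤ := if δ = 2 then 1 else if δ = 3 then 0 else 3

/-- The double eta-quotient `𝔴_{p₁,p₂}(z) = η(z/p₁) η(z/p₂) / (η(z/(p₁p₂)) η(z))`. -/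
noncomputable def w (p₁ p₂ : ℕ) (z : ℂ) : ℂ :=
  ModularForm.eta (z / p₁) * ModularForm.eta (z / p₂) /
    (ModularForm.eta (z / (p₁ * p₂)) * ModularForm.eta z)

/-- `A_ν(z) = 𝔴_{p₁,p₂}(z + ν)`. -/
noncomputable def A (p₁ p₂ ν : ℕ) (z : ℂ) : ℂ := w p₁ p₂ (z + ν)

/-- `B(z) = η(p₁z) η(p₂z) / (η(z) η(p₁p₂z))`. -/
noncomputable def B (p₁ p₂ : ℕ) (z : ℂ) : ℂ :=
  ModularForm.eta (p₁ * z) * ModularForm.eta (p₂ * z) /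
    (ModularForm.eta z * ModularForm.eta (p₁ * p₂ * z))

/-! For distinct primes, one definition serves for `C_{1,ν}` and `C_{2,ν}`.
In the following definitions `q` is the prime that indexes the family and `p` is the other one,
and `u p + v q = 1`. So `C_{2,ν}` is obtained with `(p, q, u, v) = (p₁, p₂, u, v)` and
`C_{1,ν}` with `(p, q, u, v) = (p₂, p₁, v, u)`. -/

/-- The representative in `{0, …, q - 1}` of `-(ν p)⁻¹` modulo `q`. -/
def mu (p q ν : ℕ) : ℕ := (-((ν * p : ZMod q)⁻¹)).val

/-- The exponent `θ(ν)`. All integer divisions are exact: for `ν ≠ 0` the integer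
`(1 + p μ ν) / q` is the `v₂` with `q v₂ = 1 + p μ ν`, and for `q = 2` only `ν = 0, 1` occur,
while `u` is odd. -/
def theta (p q : ℕ) (u v : ℤ) (ν : ℕ) : ℤ :=
  if ν = 0 then
    if q = 2 then (3 * u + 2) * (u - 1) / 2 else u * v * (q + 1) + u - 1
  else
    if q = 2 then (3 * p + 2) * (((ν : ℤ) + 1) / 2)
    else (mu p q ν : ℤ) * ((q + 1) * ((1 + (p : ℤ) * mu p q ν * ν) / q) + 1) + ν

/-- The Legendre symbol `(p / q)` for `q` odd, and `1` for `q = 2`. -/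
def eps (p q : ℕ) : ℤ := if q = 2 then 1 else jacobiSym p q

/-- `C_ν(z) = φ^{θ(ν)} ε η(p(z+ν)) η((z+ν)/q) / (η(z+ν) η(p(z+ν)/q))`, for `0 ≤ ν < q`. -/
noncomputable def C (p q : ℕ) (u v : ℤ) (ν : ℕ) (z : ℂ) : ℂ :=
  phi p q ^ theta p q u v ν * (eps p q : ℂ) *
    (ModularForm.eta (p * (z + ν)) * ModularForm.eta ((z + ν) / q) /
      (ModularForm.eta (z + ν) * ModularForm.eta (p * (z + ν) / q)))

/-! The family that replaces the two preceding ones when `p₁ = p₂ = p`. -/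

/-- The representative in `{0, …, p - 1}` of `-ν⁻¹` modulo `p`. -/
def muEq (p ν : ℕ) : ℕ := (-((ν : ZMod p)⁻¹)).val

/-- The exponent `θ(ν)` in the case `p₁ = p₂ = p`; the (exact) quotient `(1 + μ ν) / p` is the
`v` with `1 = -μ ν + v p`. -/
def thetaEq (p ν : ℕ) : ℤ :=
  if p = 2 then 0
  else
    p * ν * (1 - (muEq p ν : ℤ) ^ 2)
      + (-3 * p + 2 + (1 + (muEq p ν : ℤ) * ν) / p) * muEq p ν - 3 + 3 * p

/-- The Legendre symbol `(-ν / p)` for `p` odd, and `1` for `p = 2`. -/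
def epsEq (p ν : ℕ) : ℤ := if p = 2 then 1 else jacobiSym (-(ν : ℤ)) p

/-- `C_ν(z) = √p ε(ν) ζ₂₄^{θ(ν)} η(pz)² / (η(z) η(z + ν/p))`, for `1 ≤ ν < p`. -/
noncomputable def CEq (p ν : ℕ) (z : ℂ) : ℂ :=
  (Real.sqrt p : ℂ) * (epsEq p ν : ℂ) * zeta 24 ^ thetaEq p ν *
    (ModularForm.eta (p * z) ^ 2 / (ModularForm.eta z * ModularForm.eta (z + ν / p)))

/-! The twisted functions. -/

/-- `A'_ν = χ^{α₀ - ν} A_ν^e`, where `δ = s / e`. -/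
noncomputable def A' (p₁ p₂ e ν : ℕ) (z : ℂ) : ℂ :=
  chi p₁ p₂ e ^ (alpha0 (s p₁ p₂ / e) - ν) * A p₁ p₂ ν z ^ e

/-- `B' = B^e`. -/
noncomputable def B' (p₁ p₂ e : ℕ) (z : ℂ) : ℂ := B p₁ p₂ z ^ e

/-- `C'_{1,ν} = χ^{θ₁(ν) - ν} C_{1,ν}^e`. -/
noncomputable def C₁' (p₁ p₂ e : ℕ) (u v : ℤ) (ν : ℕ) (z : ℂ) : ℂ :=
  chi p₁ p₂ e ^ (theta p₂ p₁ v u ν - ν) * C p₂ p₁ v u ν z ^ e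

/-- `C'_{2,ν} = χ^{θ₂(ν) - ν} C_{2,ν}^e`. -/
noncomputable def C₂' (p₁ p₂ e : ℕ) (u v : ℤ) (ν : ℕ) (z : ℂ) : ℂ :=
  chi p₁ p₂ e ^ (theta p₁ p₂ u v ν - ν) * C p₁ p₂ u v ν z ^ e

/-- `C'_ν = χ^μ C_ν^e` in the case `p₁ = p₂ = p`. -/
noncomputable def CEq' (p e ν : ℕ) (z : ℂ) : ℂ :=
  chi p p e ^ muEq p ν * CEq p ν z ^ e

/-- The `k`-th power sum of all twisted conjugates: the functions `B'`, `A'_ν` together with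
`C'_{1,ν}` and `C'_{2,ν}` when `p₁ ≠ p₂`, or with `C'_ν` when `p₁ = p₂`. -/
noncomputable def powerSum (p₁ p₂ e : ℕ) (u v k : ℤ) (z : ℂ) : ℂ :=
  B' p₁ p₂ e z ^ k + (∑ ν ∈ Finset.range (p₁ * p₂), A' p₁ p₂ e ν z ^ k) +
    (if p₁ = p₂ then ∑ ν ∈ Finset.Ico 1 p₁, CEq' p₁ e ν z ^ k
    else (∑ ν ∈ Finset.range p₁, C₁' p₁ p₂ e u v ν z ^ k) +
      (∑ ν ∈ Finset.range p₂, C₂' p₁ p₂ e u v ν z ^ k))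

end DoubleEta

/-! Each generator of the modular group permutes the twisted conjugates up to one common constant: χ
for z ↦ z + 1 and χ^α₀ for z ↦ -1/z. A power sum is therefore multiplied by the k-th power of that
constant.

Translation shifts the index of A' and of C'₁, C'₂. The indices wrap around because N ≡ 1 and p₁ ≡
p₂ ≡ -1 modulo δ (`twA_periodic`, `twC_periodic`, `delta_dvd_succ`). B' and, for equal primes, each
C'_ν are eigenfunctions.

Inversion exchanges B' with A'_0, sends A'_ν for ν prime to N to A'_μ with μ ≡ -ν⁻¹, exchanges the
other A' with the C' of nonzero index, and exchanges C'_{1,0} with C'_{2,0}. This last exchange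
rests on quadratic reciprocity (`eps_mul_eps_pow`). Those with ν ≠ 0 need η under general
substitutions with its exact root of unity, which is `etaLaw`: a Euclidean induction on the odd
lower left entry c. Translations make d odd with |d| < c, composition with inversion turns |d| into
the lower left entry, and Jacobi reciprocity matches the symbols.

The law is applied at points where cz + d becomes z or pz (`inversion_shift`), so the square roots
cancel up to a constant in each η-quotient. For distinct primes, and for ν prime to N, the exponent
of ζ₂₄ is a multiple of (p₁ - 1)(p₂ - 1), and the e-th power turns it into a power of χ
(`zeta_zpow_eq_chi`). For equal primes and p ∣ ν, multiples of p² - 1 remain, which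
`twentyfour_dvd_of_eq` removes. Since χ^(2α₀) = 1, `inversion_symm` yields the reverse direction of
an exchange. -/

open Complex hiding eta
open ModularForm

namespace DoubleEta

/-! ### The branch `√(-iz)` on the upper half-plane -/

/-- The principal branch of `√(-iz)`. -/
noncomputable def rootI (z : ℂ) : ℂ := Complex.sqrt (-I * z)

lemma sqrt_sq (z : ℂ) : Complex.sqrt z ^ 2 = z := by
  rw [Complex.sqrt, ← Complex.cpow_mul_nat]
  simp

lemma rootI_sq (z : ℂ) : rootI z ^ 2 = -I * z := sqrt_sq _

/-- The square -iz has real part Im z > 0, so the principal root lies in the sector |arg| < π/4. A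
product of two such roots, or such a root rotated by ±π/4, stays in the right half-plane. -/
lemma abs_im_rootI_lt {z : ℂ} (hz : 0 < z.im) : |(rootI z).im| < (rootI z).re := by
  have h0 : 0 ≤ (rootI z).re := by
    rw [rootI, Complex.sqrt, Complex.cpow_inv_two_re]
    exact Real.sqrt_nonneg _
  have h1 := congrArg Complex.re (rootI_sq z)
  simp [pow_two] at h1
  exact abs_lt_of_sq_lt_sq (by nlinarith) h0

/-- All identities between branches are settled this way: compare squares, then exclude the sign by
positivity of the real parts. -/
lemma eq_of_sq_eq_sq_of_re_pos {x y : ℂ} (h : x ^ 2 = y ^ 2) (hx : 0 < x.re) (hy : 0 < y.re) :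
    x = y := by
  rcases sq_eq_sq_iff_eq_or_eq_neg.mp h with h | h
  · exact h
  · rw [h, Complex.neg_re] at hx
    linarith

lemma rootI_mul_rootI_re_pos {z w : ℂ} (hz : 0 < z.im) (hw : 0 < w.im) :
    0 < (rootI z * rootI w).re := by
  have h1 := abs_lt.mp (abs_im_rootI_lt hz)
  have h2 := abs_lt.mp (abs_im_rootI_lt hw)
  rw [Complex.mul_re]
  nlinarith

lemma rootI_ne_zero {z : ℂ} (hz : 0 < z.im) : rootI z ≠ 0 := fun h => by
  have := abs_im_rootI_lt hz
  simp [h] at this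

lemma rootI_ofReal_mul {t : ℝ} (ht : 0 < t) {z : ℂ} (hz : 0 < z.im) :
    rootI (t * z) = Real.sqrt t * rootI z := by
  have h3 : ((Real.sqrt t : ℝ) : ℂ) ^ 2 = t := by
    exact_mod_cast Real.sq_sqrt ht.le
  apply eq_of_sq_eq_sq_of_re_pos
  · rw [mul_pow, rootI_sq, rootI_sq, h3]
    ring
  · refine lt_of_le_of_lt (abs_nonneg _) (abs_im_rootI_lt (z := t * z) ?_)
    simp only [Complex.mul_im, Complex.ofReal_re, Complex.ofReal_im]
    simpa using mul_pos ht hz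
  · have := lt_of_le_of_lt (abs_nonneg _) (abs_im_rootI_lt hz)
    simp only [Complex.mul_re, Complex.ofReal_re, Complex.ofReal_im]
    have h := mul_pos (Real.sqrt_pos.mpr ht) this
    linarith

/-! ### Roots of unity -/

lemma zeta_ne_zero (n : ℕ) : zeta n ≠ 0 := Complex.exp_ne_zero _

lemma zeta_pow_self {n : ℕ} (hn : n ≠ 0) : zeta n ^ n = 1 :=
  (Complex.isPrimitiveRoot_exp n hn).pow_eq_one

lemma zeta_zpow_of_dvd {a : ℤ} (h : (24 : ℤ) ∣ a) : zeta 24 ^ a = 1 := by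
  obtain ⟨k, rfl⟩ := h
  rw [zpow_mul, show ((24 : ℤ)) = ((24 : ℕ) : ℤ) from rfl, zpow_natCast,
    zeta_pow_self (by norm_num), one_zpow]

lemma zeta_zpow_congr {a b : ℤ} (h : (24 : ℤ) ∣ a - b) : zeta 24 ^ a = zeta 24 ^ b := by
  rw [← sub_add_cancel a b, zpow_add₀ (zeta_ne_zero _), zeta_zpow_of_dvd h, one_mul]

lemma zeta_pow_three : zeta 24 ^ (3 : ℤ) = Real.sqrt 2 / 2 * (1 + I) := by
  rw [zeta, ← Complex.exp_int_mul]
  rw [show ((3 : ℤ) : ℂ) * (2 * Real.pi * I / ((24 : ℕ) : ℂ)) = ((Real.pi / 4 : ℝ) : ℂ) * I by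
    push_cast; ring]
  rw [Complex.exp_mul_I, ← Complex.ofReal_cos, ← Complex.ofReal_sin, Real.cos_pi_div_four,
    Real.sin_pi_div_four]
  push_cast
  ring

lemma zeta_pow_neg_three : zeta 24 ^ (-3 : ℤ) = Real.sqrt 2 / 2 * (1 - I) := by
  rw [zeta, ← Complex.exp_int_mul]
  rw [show ((-3 : ℤ) : ℂ) * (2 * Real.pi * I / ((24 : ℕ) : ℂ)) = ((-(Real.pi / 4) : ℝ) : ℂ) * I by
    push_cast; ring]
  rw [Complex.exp_mul_I, ← Complex.ofReal_cos, ← Complex.ofReal_sin, Real.cos_neg, Real.sin_neg,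
    Real.cos_pi_div_four, Real.sin_pi_div_four]
  push_cast
  ring

lemma zeta_pow_six : zeta 24 ^ (6 : ℤ) = I := by
  have h : ((Real.sqrt 2 : ℝ) : ℂ) ^ 2 = 2 := by exact_mod_cast Real.sq_sqrt (by norm_num)
  rw [show (6 : ℤ) = 3 * 2 by norm_num, zpow_mul, zeta_pow_three]
  rw [show ((2 : ℤ)) = ((2 : ℕ) : ℤ) from rfl, zpow_natCast]
  linear_combination (1 + I) ^ 2 / 4 * h + (1 / 2) * Complex.I_sq

lemma zeta_pow_twelve : zeta 24 ^ (12 : ℤ) = -1 := by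
  rw [show (12 : ℤ) = 6 * 2 by norm_num, zpow_mul, zeta_pow_six]
  exact_mod_cast Complex.I_sq

lemma zeta_pow_three_mul_rootI_re_pos {z : ℂ} (hz : 0 < z.im) :
    0 < (zeta 24 ^ (3 : ℤ) * rootI z).re := by
  have h1 := abs_lt.mp (abs_im_rootI_lt hz)
  have h2 : 0 < Real.sqrt 2 / 2 := by positivity
  have : (zeta 24 ^ (3 : ℤ) * rootI z).re = Real.sqrt 2 / 2 * ((rootI z).re - (rootI z).im) := by
    rw [zeta_pow_three, show ((Real.sqrt 2 : ℝ) : ℂ) / 2 = ((Real.sqrt 2 / 2 : ℝ) : ℂ) by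
      push_cast; ring, mul_assoc, Complex.re_ofReal_mul]
    simp
  rw [this]
  exact mul_pos h2 (by linarith)

lemma zeta_pow_neg_three_mul_rootI_re_pos {z : ℂ} (hz : 0 < z.im) :
    0 < (zeta 24 ^ (-3 : ℤ) * rootI z).re := by
  have h1 := abs_lt.mp (abs_im_rootI_lt hz)
  have h2 : 0 < Real.sqrt 2 / 2 := by positivity
  have : (zeta 24 ^ (-3 : ℤ) * rootI z).re = Real.sqrt 2 / 2 * ((rootI z).re + (rootI z).im) := by
    rw [zeta_pow_neg_three, show ((Real.sqrt 2 : ℝ) : ℂ) / 2 = ((Real.sqrt 2 / 2 : ℝ) : ℂ) by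
      push_cast; ring, mul_assoc, Complex.re_ofReal_mul]
    simp
  rw [this]
  exact mul_pos h2 (by linarith)

/-! ### The branch √(-iz) under composition with inversion -/

lemma neg_one_div_im_pos {z : ℂ} (hz : 0 < z.im) : 0 < (-1 / z).im := by
  have hz0 : z ≠ 0 := fun h => by simp [h] at hz
  rw [neg_div, Complex.neg_im, one_div, Complex.inv_im, neg_div, neg_neg]
  exact div_pos hz (Complex.normSq_pos.mpr hz0)

/-- For `c, d > 0`, and `w = -1/z`: `√(-i(dw - c)) √(-iz) = ζ₈ √(-i(cz + d))`. -/
lemma rootI_cocycle_pos {c d : ℤ} (hc : 0 < c) (hd : 0 < d) {z : ℂ} (hz : 0 < z.im) :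
    rootI (d * (-1 / z) + (-c : ℤ)) * rootI z = zeta 24 ^ (3 : ℤ) * rootI (c * z + d) := by
  have hz0 : z ≠ 0 := fun h => by simp [h] at hz
  have hw := neg_one_div_im_pos hz
  apply eq_of_sq_eq_sq_of_re_pos
  · rw [mul_pow, mul_pow, rootI_sq, rootI_sq, rootI_sq, ← zpow_natCast, ← zpow_mul]
    norm_num only
    rw [zeta_pow_six]
    push_cast
    field_simp
    ring
  · apply rootI_mul_rootI_re_pos _ hz
    have : (0 : ℝ) < d := by exact_mod_cast hd
    simpa using mul_pos this hw
  · apply zeta_pow_three_mul_rootI_re_pos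
    have : (0 : ℝ) < c := by exact_mod_cast hc
    simpa using mul_pos this hz

/-- For `c > 0 > d`, and `w = -1/z`: `√(-i(-dw + c)) √(-iz) = ζ₈⁻¹ √(-i(cz + d))`. -/
lemma rootI_cocycle_neg {c d : ℤ} (hc : 0 < c) (hd : d < 0) {z : ℂ} (hz : 0 < z.im) :
    rootI ((-d : ℤ) * (-1 / z) + c) * rootI z = zeta 24 ^ (-3 : ℤ) * rootI (c * z + d) := by
  have hz0 : z ≠ 0 := fun h => by simp [h] at hz
  have hw := neg_one_div_im_pos hz
  apply eq_of_sq_eq_sq_of_re_pos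
  · rw [mul_pow, mul_pow, rootI_sq, rootI_sq, rootI_sq, ← zpow_natCast, ← zpow_mul]
    rw [show (-3 : ℤ) * ((2 : ℕ) : ℤ) = -6 by norm_num, zpow_neg, zeta_pow_six, Complex.inv_I]
    push_cast
    field_simp
    ring
  · apply rootI_mul_rootI_re_pos _ hz
    have : (0 : ℝ) < ((-d : ℤ) : ℝ) := by exact_mod_cast neg_pos.mpr hd
    have := mul_pos this hw
    simpa using this
  · apply zeta_pow_neg_three_mul_rootI_re_pos
    have : (0 : ℝ) < c := by exact_mod_cast hc
    simpa using mul_pos this hz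

/-! ### The eta function under the generators -/

lemma eta_add_one (z : ℂ) : eta (z + 1) = zeta 24 * eta z := by
  have h : Function.Periodic.qParam 1 (z + 1) = Function.Periodic.qParam 1 z := by
    rw [Function.Periodic.qParam, Function.Periodic.qParam]
    rw [show 2 * (Real.pi : ℂ) * I * (z + 1) / ((1 : ℝ) : ℂ) = 2 * Real.pi * I * z / ((1 : ℝ) : ℂ) + 2 * Real.pi * I by
      push_cast; ring, Complex.exp_add, Complex.exp_two_pi_mul_I, mul_one]
  have h' : Function.Periodic.qParam 24 (z + 1) = zeta 24 * Function.Periodic.qParam 24 z := by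
    rw [zeta, Function.Periodic.qParam, Function.Periodic.qParam, ← Complex.exp_add]
    congr 1
    push_cast
    ring
  simp only [eta, eta_q, h, h']
  ring

lemma eta_add_nat (z : ℂ) (k : ℕ) : eta (z + k) = zeta 24 ^ k * eta z := by
  induction k with
  | zero => simp
  | succ k ih => rw [Nat.cast_succ, ← add_assoc, eta_add_one, ih]; ring

lemma eta_add_int (z : ℂ) (k : ℤ) : eta (z + k) = zeta 24 ^ k * eta z := by
  obtain ⟨n, rfl | rfl⟩ := k.eq_nat_or_neg
  · simpa using eta_add_nat z n
  · have h := eta_add_nat (z + ((-n : ℤ) : ℂ)) n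
    have h0 := pow_ne_zero n (zeta_ne_zero 24)
    rw [zpow_neg, zpow_natCast, eq_inv_mul_iff_mul_eq₀ h0, ← h]
    congr 1
    push_cast
    ring

lemma eta_neg_one_div {z : ℂ} (hz : 0 < z.im) : eta (-1 / z) = rootI z * eta z := by
  have h := eta_comp_eq_csqrt_I_inv (show z ∈ UpperHalfPlane.upperHalfPlaneSet from hz)
  simp only [Function.comp_apply, Pi.smul_apply, Pi.mul_apply, smul_eq_mul] at h
  have h6 : (Complex.sqrt I) = zeta 24 ^ (3 : ℤ) := by
    rw [zeta_pow_three, Complex.sqrt_I]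
    congr 1
    rw [Real.sqrt_inv]
    have h : ((Real.sqrt 2 : ℝ) : ℂ) ^ 2 = 2 := by exact_mod_cast Real.sq_sqrt (by norm_num)
    have h' : ((Real.sqrt 2 : ℝ) : ℂ) ≠ 0 := fun h0 => by simp [h0] at h
    push_cast
    field_simp
    exact h.symm
  have key : zeta 24 ^ (3 : ℤ) * rootI z = Complex.sqrt z := by
    apply eq_of_sq_eq_sq_of_re_pos
    · rw [mul_pow, rootI_sq, sqrt_sq, ← zpow_natCast, ← zpow_mul]
      norm_num only
      rw [zeta_pow_six]
      linear_combination -z * Complex.I_sq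
    · exact zeta_pow_three_mul_rootI_re_pos hz
    · rw [Complex.sqrt, Complex.cpow_inv_two_re]
      apply Real.sqrt_pos.mpr
      have := Complex.abs_re_lt_norm.mpr hz.ne'
      have := abs_lt.mp this
      linarith
  rw [h, h6, ← key, mul_assoc, ← mul_assoc, inv_mul_cancel₀ (zpow_ne_zero _ (zeta_ne_zero _)),
    one_mul]

/-! ### The eta function under general modular substitutions -/

lemma twentyfour_dvd_cube_sub {c : ℤ} (hc : Odd c) : (24 : ℤ) ∣ c * (c ^ 2 - 1) := by
  obtain ⟨m, rfl⟩ := hc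
  have h2 : (2 : ℤ) ∣ m * (m + 1) := even_iff_two_dvd.mp (Int.even_mul_succ_self m)
  have h3 : (3 : ℤ) ∣ (2 * m + 1) * (m * (m + 1)) := by
    have : m % 3 = 0 ∨ m % 3 = 1 ∨ m % 3 = 2 := by omega
    apply Int.dvd_of_emod_eq_zero
    rcases this with h | h | h <;> simp [Int.mul_emod, Int.add_emod, h]
  have h6 : (6 : ℤ) ∣ (2 * m + 1) * (m * (m + 1)) := by
    have := h2.mul_left (2 * m + 1)
    omega
  obtain ⟨t, ht⟩ := h6
  exact ⟨t, by linear_combination 4 * ht⟩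

/-- Writing the sign as a power of ζ₂₄ turns reciprocity into an addition of exponents, so that
transformation laws can be compared by integer identities. -/
lemma jacobiSym_reciprocity_zeta {m n : ℕ} (hm : Odd m) (hn : Odd n) :
    (jacobiSym m n : ℂ) = zeta 24 ^ (3 * ((m : ℤ) - 1) * (n - 1)) * jacobiSym n m := by
  rw [jacobiSym.quadratic_reciprocity hm hn]
  obtain ⟨a, rfl⟩ := hm
  obtain ⟨b, rfl⟩ := hn
  have h1 : (2 * a + 1) / 2 = a := by omega
  have h2 : (2 * b + 1) / 2 = b := by omega
  rw [h1, h2, show 3 * (((2 * a + 1 : ℕ) : ℤ) - 1) * (((2 * b + 1 : ℕ) : ℤ) - 1) = 12 * ((a * b : ℕ) : ℤ) by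
    push_cast; ring, zpow_mul, zeta_pow_twelve, zpow_natCast]
  push_cast
  ring

lemma jacobiSym_neg_zeta (a : ℤ) {n : ℕ} (hn : Odd n) :
    (jacobiSym (-a) n : ℂ) = zeta 24 ^ (6 * ((n : ℤ) - 1)) * jacobiSym a n := by
  rw [jacobiSym.neg _ hn, ZMod.χ₄_eq_neg_one_pow (Nat.odd_iff.mp hn)]
  obtain ⟨b, rfl⟩ := hn
  have h2 : (2 * b + 1) / 2 = b := by omega
  rw [h2, show 6 * (((2 * b + 1 : ℕ) : ℤ) - 1) = 12 * (b : ℤ) by push_cast; ring, zpow_mul,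
    zeta_pow_twelve, zpow_natCast]
  push_cast
  ring

lemma mobius_comp_inversion {a b c d : ℤ} {z : ℂ} (hz : 0 < z.im) :
    ((b : ℂ) * (-1 / z) + ((-a : ℤ) : ℂ)) / (d * (-1 / z) + ((-c : ℤ) : ℂ)) =
      (a * z + b) / (c * z + d) := by
  have hz0 : z ≠ 0 := fun h => by simp [h] at hz
  rw [← mul_div_mul_right _ _ (neg_ne_zero.mpr hz0)]
  congr 1 <;> (push_cast; field_simp; ring_nf)

/-- The exponent of `ζ₂₄` in the transformation law of `η` for odd `c`. -/
def etaExp (a b c d : ℤ) : ℤ := (a + d) * c - b * d * (c ^ 2 - 1) - 3 * c + 3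

/-- `η((az + b)/(cz + d))` for odd `c > 0`. -/
def EtaLaw (c : ℕ) : Prop :=
  ∀ a b d : ℤ, a * d - b * c = 1 → ∀ z : ℂ, 0 < z.im →
    eta ((a * z + b) / ((c : ℤ) * z + d)) =
      jacobiSym d c * zeta 24 ^ etaExp a b c d * rootI ((c : ℤ) * z + d) * eta z

/-- Write the substitution as M S⁻¹ applied to w = -1/z. The lower row of M S⁻¹ is (d, -c), so the
law for d applies; the extra 3 comes from `rootI_cocycle_pos`. -/
lemma eta_of_etaLaw_pos {c d : ℕ} (hc : 0 < c) (hd : 0 < d) (H : EtaLaw d) {a b : ℤ}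
    (h : a * d - b * c = 1) {z : ℂ} (hz : 0 < z.im) :
    eta ((a * z + b) / ((c : ℤ) * z + (d : ℤ))) =
      jacobiSym (-c) d * zeta 24 ^ (etaExp b (-a) d (-c) + 3) * rootI ((c : ℤ) * z + (d : ℤ)) *
        eta z := by
  have hw := neg_one_div_im_pos hz
  have h1 := H b (-a) (-c) (by linear_combination h) _ hw
  rw [mobius_comp_inversion (a := a) (b := b) (c := c) (d := d) hz, eta_neg_one_div hz] at h1
  have h2 := rootI_cocycle_pos (c := c) (d := d) (by exact_mod_cast hc) (by exact_mod_cast hd) hz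
  rw [h1, zpow_add₀ (zeta_ne_zero _)]
  linear_combination (jacobiSym (-c) d : ℂ) * zeta 24 ^ (etaExp b (-a) d (-c)) * eta z * h2

/-- With d = -t the lower row of M S⁻¹ is (-t, -c). Negating the matrix leaves the substitution
unchanged and makes the lower left entry t positive. -/
lemma eta_of_etaLaw_neg {c t : ℕ} (hc : 0 < c) (ht : 0 < t) (H : EtaLaw t) {a b : ℤ}
    (h : a * (-t) - b * c = 1) {z : ℂ} (hz : 0 < z.im) :
    eta ((a * z + b) / ((c : ℤ) * z + ((-t : ℤ) : ℂ))) =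
      jacobiSym c t * zeta 24 ^ (etaExp (-b) a t c - 3) * rootI ((c : ℤ) * z + ((-t : ℤ) : ℂ)) *
        eta z := by
  have hw := neg_one_div_im_pos hz
  have h1 := H (-b) a c (by linear_combination h) _ hw
  have h3 := mobius_comp_inversion (a := -a) (b := -b) (c := -c) (d := t) hz
  rw [neg_neg, neg_neg] at h3
  have h4 : (((-a : ℤ) : ℂ) * z + ((-b : ℤ) : ℂ)) / (((-c : ℤ) : ℂ) * z + ((t : ℤ) : ℂ)) =
      (a * z + b) / ((c : ℤ) * z + ((-t : ℤ) : ℂ)) := by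
    rw [← neg_div_neg_eq]
    push_cast
    congr 1 <;> ring
  rw [h3, h4, eta_neg_one_div hz] at h1
  have h2 := rootI_cocycle_neg (c := c) (d := -t) (by exact_mod_cast hc)
    (by simpa using ht) hz
  rw [neg_neg] at h2
  rw [h1, sub_eq_add_neg, zpow_add₀ (zeta_ne_zero _)]
  linear_combination (jacobiSym c t : ℂ) * zeta 24 ^ (etaExp (-b) a t c) * eta z * h2

/-- Consistency of the law with z ↦ z + k: by the determinant relation, the discrepancy is a
multiple of c(c² - 1), which 24 divides for odd c. -/
lemma etaExp_shift {a b c d k : ℤ} (hc : Odd c) (h : a * d - b * c = 1) :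
    (24 : ℤ) ∣ etaExp a b c d - (etaExp a (b + k * a) c (d + k * c) - k) := by
  obtain ⟨t, ht⟩ := twentyfour_dvd_cube_sub hc
  refine ⟨t * (k * (2 * b + k * a)), ?_⟩
  rw [etaExp, etaExp]
  linear_combination (k * (2 * b + k * a)) * ht + k * (c ^ 2 - 1) * h

/-- The transformation law of `η` for matrices with odd lower left entry `c > 0`. -/
theorem etaLaw (c : ℕ) (hc : Odd c) : EtaLaw c := by
  induction c using Nat.strong_induction_on with
  | _ c ih =>
  have hc0 : 0 < c := hc.pos
  have hcZ : Odd (c : ℤ) := by exact_mod_cast hc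
  -- reduction of `d` modulo `c`
  have reduce : ∀ a b d k : ℤ, a * d - b * c = 1 →
      (∀ z : ℂ, 0 < z.im → eta ((a * z + (b + k * a : ℤ)) / ((c : ℤ) * z + (d + k * c : ℤ))) =
        jacobiSym (d + k * c) c * zeta 24 ^ etaExp a (b + k * a) c (d + k * c) *
          rootI ((c : ℤ) * z + (d + k * c : ℤ)) * eta z) →
      ∀ z : ℂ, 0 < z.im → eta ((a * z + b) / ((c : ℤ) * z + d)) =
        jacobiSym d c * zeta 24 ^ etaExp a b c d * rootI ((c : ℤ) * z + d) * eta z := by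
    intro a b d k h H z hz
    have h1 := H (z + ((-k : ℤ) : ℂ)) (by simpa using hz)
    rw [eta_add_int] at h1
    have e1 : (a : ℂ) * (z + ((-k : ℤ) : ℂ)) + (b + k * a : ℤ) = a * z + b := by push_cast; ring
    have e2 : ((c : ℤ) : ℂ) * (z + ((-k : ℤ) : ℂ)) + (d + k * c : ℤ) = (c : ℤ) * z + d := by
      push_cast; ring
    have e3 : jacobiSym (d + k * c) c = jacobiSym d c :=
      jacobiSym.mod_left' (by simp)
    rw [e1, e2, e3] at h1
    rw [h1, zeta_zpow_congr (etaExp_shift (k := k) hcZ h), sub_eq_add_neg (etaExp _ _ _ _) k,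
      zpow_add₀ (zeta_ne_zero _)]
    ring
  intro a b d h
  rcases Nat.eq_or_lt_of_le (show 1 ≤ c from hc0) with h1 | h1
  · subst h1
    intro z hz
    have hb : b = a * d - 1 := by linear_combination -h
    have hzd : 0 < (z + d : ℂ).im := by simpa using hz
    have hne : (z + d : ℂ) ≠ 0 := fun h0 => by simp [h0] at hzd
    have e : ((a : ℂ) * z + b) / (((1 : ℕ) : ℤ) * z + d) = -1 / (z + d) + a := by
      rw [hb]
      push_cast
      rw [one_mul]
      field_simp
      ring
    rw [e, eta_add_int, eta_neg_one_div hzd, eta_add_int]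
    have e2 : etaExp a b ((1 : ℕ) : ℤ) d = a + d := by rw [etaExp]; push_cast; ring
    rw [e2, zpow_add₀ (zeta_ne_zero _), jacobiSym.one_right]
    push_cast
    rw [one_mul]
    ring_nf
  -- choose an odd representative of `d`
  obtain ⟨k, hk⟩ : ∃ k : ℤ, Odd (d + k * c) ∧ -(c : ℤ) < d + k * c ∧ d + k * c < c := by
    have hcpos : (0 : ℤ) < c := by exact_mod_cast hc0
    have hd0 := Int.emod_nonneg d hcpos.ne'
    have hdc := Int.emod_lt_of_pos d hcpos
    have hdm : d + (-(d / c)) * c = d % c := by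
      have := Int.emod_add_mul_ediv d c
      linear_combination -this
    -- As c is odd, `d % c` and `d % c - c` have opposite parity. In the even case the residue is
    -- nonzero, because c > 1 is prime to d, so the second choice exceeds -c.
    rcases Int.even_or_odd (d % c) with he | ho
    · refine ⟨-(d / c) - 1, ?_⟩
      have e : d + (-(d / c) - 1) * c = d % c - c := by linear_combination hdm
      rw [e]
      have hne : d % c ≠ 0 := by
        intro h0
        have hdvd : (c : ℤ) ∣ 1 := by
          rw [← h]
          exact dvd_sub ((Int.dvd_of_emod_eq_zero h0).mul_left a) (Dvd.intro_left b rfl)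
        have := Int.le_of_dvd one_pos hdvd
        omega
      exact ⟨he.sub_odd hcZ, by omega, by omega⟩
    · exact ⟨-(d / c), by rw [hdm]; exact ⟨ho, by omega, hdc⟩⟩
  apply reduce a b d k h
  have hdet : a * (d + k * c) - (b + k * a) * c = 1 := by linear_combination h
  generalize b + k * a = b' at hdet ⊢
  generalize d + k * c = d' at hdet hk ⊢
  obtain ⟨hodd, hlo, hhi⟩ := hk
  intro z hz
  obtain ⟨t, rfl | rfl⟩ := d'.eq_nat_or_neg
  · have ht : Odd t := by exact_mod_cast hodd
    rw [eta_of_etaLaw_pos hc0 ht.pos (ih t (by exact_mod_cast hhi) ht) hdet hz]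
    congr 2
    have e : etaExp a b' c t =
        6 * ((t : ℤ) - 1) + (3 * ((c : ℤ) - 1) * (t - 1) + (etaExp b' (-a) t (-c) + 3)) := by
      rw [etaExp, etaExp]
      linear_combination ((c : ℤ) * t) * hdet
    rw [e, jacobiSym_neg_zeta _ ht, jacobiSym_reciprocity_zeta hc ht,
      zpow_add₀ (zeta_ne_zero 24) (6 * ((t : ℤ) - 1)),
      zpow_add₀ (zeta_ne_zero 24) (3 * ((c : ℤ) - 1) * (t - 1))]
    ring
  · have ht : Odd t := by simpa using hodd
    rw [eta_of_etaLaw_neg hc0 ht.pos (ih t (by omega) ht) hdet hz]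
    congr 2
    -- Unlike for positive d, the exponents agree only modulo 24: they differ by 6(c - 1)(t - 1) =
    -- 24xy.
    have h24 : (24 : ℤ) ∣ (3 * ((c : ℤ) - 1) * (t - 1) + (etaExp (-b') a t c - 3)) -
        (6 * ((c : ℤ) - 1) + etaExp a b' c (-t)) := by
      obtain ⟨x, hx⟩ := hc
      obtain ⟨y, hy⟩ := ht
      have hx' : (c : ℤ) = 2 * x + 1 := by exact_mod_cast hx
      have hy' : (t : ℤ) = 2 * y + 1 := by exact_mod_cast hy
      refine ⟨x * y, ?_⟩
      rw [etaExp, etaExp]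
      linear_combination ((c : ℤ) * t) * hdet + 6 * ((t : ℤ) - 1) * hx' + 12 * (x : ℤ) * hy'
    have e := zeta_zpow_congr h24
    rw [zpow_add₀ (zeta_ne_zero 24), zpow_add₀ (zeta_ne_zero 24)] at e
    rw [jacobiSym_neg_zeta _ hc, jacobiSym_reciprocity_zeta hc ht]
    linear_combination (jacobiSym t c : ℂ) * e

/-- The transformation law of `η` for matrices with lower row `c > 0` and odd `d > 0`. -/
theorem eta_law_of_odd_right {c d : ℕ} (hc : 0 < c) (hd : Odd d) {a b : ℤ}
    (h : a * d - b * c = 1) {z : ℂ} (hz : 0 < z.im) :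
    eta ((a * z + b) / ((c : ℤ) * z + (d : ℤ))) =
      jacobiSym (-c) d * zeta 24 ^ (etaExp b (-a) d (-c) + 3) * rootI ((c : ℤ) * z + (d : ℤ)) *
        eta z :=
  eta_of_etaLaw_pos hc hd.pos (etaLaw d hd) h hz

/-! ### Arithmetic of the exponents -/

lemma s_mul_gcd (p₁ p₂ : ℕ) : s p₁ p₂ * Nat.gcd 24 ((p₁ - 1) * (p₂ - 1)) = 24 :=
  Nat.div_mul_cancel (Nat.gcd_dvd_left _ _)

lemma s_pos (p₁ p₂ : ℕ) : 0 < s p₁ p₂ :=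
  Nat.pos_of_ne_zero fun h => by simpa [h] using s_mul_gcd p₁ p₂

lemma s_comm (p₁ p₂ : ℕ) : s p₁ p₂ = s p₂ p₁ := by rw [s, s, mul_comm]

lemma phi_comm (p₁ p₂ : ℕ) : phi p₁ p₂ = phi p₂ p₁ := by rw [phi, phi, mul_comm]

lemma chi_comm (p₁ p₂ e : ℕ) : chi p₁ p₂ e = chi p₂ p₁ e := by rw [chi, chi, phi_comm]

lemma phi_ne_zero (p₁ p₂ : ℕ) : phi p₁ p₂ ≠ 0 := pow_ne_zero _ (zeta_ne_zero _)

lemma chi_ne_zero (p₁ p₂ e : ℕ) : chi p₁ p₂ e ≠ 0 := zpow_ne_zero _ (phi_ne_zero _ _)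

lemma phi_isPrimitiveRoot (p₁ p₂ : ℕ) : IsPrimitiveRoot (phi p₁ p₂) (s p₁ p₂) := by
  have h : IsPrimitiveRoot (zeta 24) 24 := Complex.isPrimitiveRoot_exp 24 (by norm_num)
  have := IsPrimitiveRoot.orderOf (phi p₁ p₂)
  rwa [phi, h.isOfFinOrder (by norm_num) |>.orderOf_pow, ← h.eq_orderOf] at this

lemma mod_three_of_not_dvd {a : ℕ} (h : ¬ 3 ∣ a - 1) (ha : 1 ≤ a) : a % 3 = 0 ∨ a % 3 = 2 := by
  omega

/-- The standing assumptions on `p₁`, `p₂`, `e` and `δ = s / e`. -/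
structure Admissible (p₁ p₂ e δ : ℕ) : Prop where
  prime₁ : p₁.Prime
  prime₂ : p₂.Prime
  mul_eq : e * δ = s p₁ p₂
  ne_one : δ ≠ 1
  modEq : p₁ * p₂ ≡ 1 [MOD δ]

namespace Admissible

variable {p₁ p₂ e δ : ℕ}

lemma symm (h : Admissible p₁ p₂ e δ) : Admissible p₂ p₁ e δ :=
  ⟨h.prime₂, h.prime₁, by rw [h.mul_eq, s_comm], h.ne_one, by rw [mul_comm]; exact h.modEq⟩

lemma mul_gcd (h : Admissible p₁ p₂ e δ) :
    e * δ * Nat.gcd 24 ((p₁ - 1) * (p₂ - 1)) = 24 := by rw [h.mul_eq, s_mul_gcd]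

lemma e_pos (h : Admissible p₁ p₂ e δ) : 0 < e :=
  Nat.pos_of_ne_zero fun h0 => by simpa [h0] using h.mul_gcd

lemma odd_of_even (h : Admissible p₁ p₂ e δ) (hδ : 2 ∣ δ) : Odd p₁ ∧ Odd p₂ := by
  have h2 : p₁ * p₂ % 2 = 1 := h.modEq.of_dvd hδ
  exact Nat.odd_mul.mp (Nat.odd_iff.mpr h2)

lemma four_dvd_of_odd (h₁ : Odd p₁) (h₂ : Odd p₂) : 4 ∣ (p₁ - 1) * (p₂ - 1) := by
  obtain ⟨a, rfl⟩ := h₁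
  obtain ⟨b, rfl⟩ := h₂
  exact ⟨a * b, by simp only [Nat.add_sub_cancel]; ring⟩

lemma dvd_six_of_odd (h : Admissible p₁ p₂ e δ) (h₁ : Odd p₁) (h₂ : Odd p₂) : e * δ ∣ 6 := by
  obtain ⟨t, ht⟩ := Nat.dvd_gcd (show 4 ∣ 24 by norm_num) (four_dvd_of_odd h₁ h₂)
  have := h.mul_gcd
  rw [ht] at this
  exact ⟨t, by linarith⟩

/-- If δ is even, then N is odd, so 4 divides (p₁ - 1)(p₂ - 1) and s, hence δ, divides 6. If δ is
odd, it is a divisor of 24 other than 1. -/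
lemma delta_cases (h : Admissible p₁ p₂ e δ) : δ = 2 ∨ δ = 3 ∨ δ = 6 := by
  have hne := h.ne_one
  have hle : δ ≤ 24 := Nat.le_of_dvd (by norm_num)
    ⟨e * Nat.gcd 24 ((p₁ - 1) * (p₂ - 1)), by linarith [h.mul_gcd]⟩
  by_cases h2 : 2 ∣ δ
  · obtain ⟨h₁, h₂⟩ := h.odd_of_even h2
    have h6 := (Dvd.intro_left e rfl).trans (h.dvd_six_of_odd h₁ h₂)
    have := Nat.le_of_dvd (by norm_num) h6
    interval_cases δ <;> omega
  · have h24 : δ ∣ 24 := ⟨e * Nat.gcd 24 ((p₁ - 1) * (p₂ - 1)), by linarith [h.mul_gcd]⟩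
    interval_cases δ <;> omega

lemma delta_eq_three (h : Admissible p₁ p₂ e δ) (h2 : p₁ = 2 ∨ p₂ = 2) : δ = 3 := by
  rcases h.delta_cases with h' | h' | h'
  · obtain ⟨h₁, h₂⟩ := h.odd_of_even ⟨1, by omega⟩
    rcases h2 with rfl | rfl
    · exact absurd h₁ (by decide)
    · exact absurd h₂ (by decide)
  · exact h'
  · obtain ⟨h₁, h₂⟩ := h.odd_of_even ⟨3, by omega⟩
    rcases h2 with rfl | rfl
    · exact absurd h₁ (by decide)
    · exact absurd h₂ (by decide)

/-- Otherwise 3 would divide both s and 24/s, and 9 would divide 24. -/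
lemma not_three_dvd (h : Admissible p₁ p₂ e δ) (h3 : 3 ∣ δ) : ¬ 3 ∣ (p₁ - 1) * (p₂ - 1) := by
  intro hd
  obtain ⟨t, ht⟩ := Nat.dvd_gcd (show 3 ∣ 24 by norm_num) hd
  obtain ⟨r, rfl⟩ := h3
  have := h.mul_gcd
  rw [ht] at this
  have h9 : 9 ∣ 24 := ⟨e * r * t, by linarith⟩
  omega

lemma mod_three (h : Admissible p₁ p₂ e δ) (h3 : 3 ∣ δ) : p₁ % 3 = 2 := by
  have hn := h.not_three_dvd h3
  have h1 : ¬ 3 ∣ p₁ - 1 := fun hd => hn (hd.mul_right _)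
  have hm : p₁ * p₂ % 3 = 1 := h.modEq.of_dvd h3
  have := h.prime₁.one_lt
  rcases mod_three_of_not_dvd h1 this.le with h' | h'
  · rw [Nat.mul_mod, h'] at hm
    simp at hm
  · exact h'

/-- By symmetry both primes are ≡ -1 modulo δ. Together with N ≡ 1 this collapses the exponents of χ
in the later computations. -/
lemma delta_dvd_succ (h : Admissible p₁ p₂ e δ) : δ ∣ p₁ + 1 := by
  have k2 : 2 ∣ δ → p₁ % 2 = 1 := fun h2 => Nat.odd_iff.mp (h.odd_of_even h2).1
  have k3 : 3 ∣ δ → p₁ % 3 = 2 := h.mod_three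
  rcases h.delta_cases with rfl | rfl | rfl <;> omega

lemma chi_isPrimitiveRoot (h : Admissible p₁ p₂ e δ) : IsPrimitiveRoot (chi p₁ p₂ e) δ := by
  have := (phi_isPrimitiveRoot p₁ p₂).pow (s_pos p₁ p₂) h.mul_eq.symm
  rw [chi, zpow_neg, zpow_natCast]
  exact this.inv

lemma chi_zpow_congr (h : Admissible p₁ p₂ e δ) {a b : ℤ} (hab : (δ : ℤ) ∣ a - b) :
    chi p₁ p₂ e ^ a = chi p₁ p₂ e ^ b := by
  rw [← sub_add_cancel a b, zpow_add₀ (chi_ne_zero _ _ _),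
    (h.chi_isPrimitiveRoot.zpow_eq_one_iff_dvd _).mpr hab, one_mul]

lemma delta_dvd_three (h : δ = 2 ∨ δ = 3 ∨ δ = 6) : (δ : ℤ) ∣ alpha0 δ + 3 ∧ (δ : ℤ) ∣ 6 := by
  rcases h with rfl | rfl | rfl <;> simp [alpha0]

lemma chi_zpow_neg_three (h : Admissible p₁ p₂ e δ) : chi p₁ p₂ e ^ (-3 : ℤ) = (-1) ^ (δ + 1) := by
  have hp := h.chi_isPrimitiveRoot
  rw [zpow_neg, show ((3 : ℤ)) = ((3 : ℕ) : ℤ) from rfl, zpow_natCast]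
  rcases h.delta_cases with rfl | rfl | rfl
  · rw [hp.eq_neg_one_of_two_right]
    norm_num
  · rw [hp.pow_eq_one]
    norm_num
  · have h2 := hp.pow (by norm_num) (show 6 = 3 * 2 by norm_num)
    rw [h2.eq_neg_one_of_two_right]
    norm_num

lemma chi_zpow_alpha0 (h : Admissible p₁ p₂ e δ) :
    chi p₁ p₂ e ^ alpha0 δ = (-1) ^ (δ + 1) := by
  rw [← h.chi_zpow_neg_three]
  exact h.chi_zpow_congr (by simpa using (delta_dvd_three h.delta_cases).1)

lemma chi_zpow_neg_alpha0 (h : Admissible p₁ p₂ e δ) :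
    chi p₁ p₂ e ^ (-alpha0 δ) = (-1) ^ (δ + 1) := by
  rw [zpow_neg, h.chi_zpow_alpha0, ← inv_pow]
  norm_num

/-- This is why the exponents of ζ₂₄ below are brought to the form (p₁ - 1)(p₂ - 1)n: only n modulo
δ then matters. -/
lemma zeta_zpow_eq_chi (p₁ p₂ e : ℕ) (h₁ : 1 ≤ p₁) (h₂ : 1 ≤ p₂) (n : ℤ) :
    (zeta 24 ^ (((p₁ : ℤ) - 1) * (p₂ - 1) * n)) ^ e = chi p₁ p₂ e ^ (-n) := by
  rw [chi, phi, ← zpow_natCast (zeta 24), ← zpow_mul, ← zpow_mul, ← zpow_natCast, ← zpow_mul]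
  congr 1
  push_cast [h₁, h₂]
  ring

lemma eight_dvd_of_odd (h : Admissible p₁ p₂ e δ) (hδ : Odd δ) (he : Odd e) :
    8 ∣ (p₁ - 1) * (p₂ - 1) := by
  have hodd : Odd (e * δ) := he.mul hδ
  have hc : Nat.Coprime 8 (e * δ) := by
    have : Nat.Coprime 2 (e * δ) := Nat.coprime_two_left.mpr hodd
    exact Nat.Coprime.pow_left 3 this
  have : 8 ∣ e * δ * Nat.gcd 24 ((p₁ - 1) * (p₂ - 1)) := by rw [h.mul_gcd]; norm_num
  exact (hc.dvd_of_dvd_mul_left this).trans (Nat.gcd_dvd_right _ _)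

lemma jacobiSym_pow_eq_one {a : ℤ} {n m : ℕ} (hm : Even m) (h : a.gcd n = 1) :
    (jacobiSym a n : ℂ) ^ m = 1 := by
  obtain ⟨k, rfl⟩ := hm
  rw [← two_mul, pow_mul]
  norm_cast
  rw [jacobiSym.sq_one h]
  simp

/-- If `p₁ = 2`, the symbols `(±2 / p₂)` disappear in the `e`-th power. -/
lemma jacobiSym_two_pow (h : Admissible 2 p₂ e δ) (h2 : p₂ ≠ 2) :
    (jacobiSym 2 p₂ : ℂ) ^ e = 1 ∧ (jacobiSym (-2) p₂ : ℂ) ^ e = 1 := by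
  have hodd : Odd p₂ := h.prime₂.odd_of_ne_two h2
  have hc : Nat.Coprime 2 p₂ := Nat.coprime_two_left.mpr hodd
  rcases Nat.even_or_odd e with he | he
  · exact ⟨jacobiSym_pow_eq_one he (by exact_mod_cast hc),
      jacobiSym_pow_eq_one he (by rw [Int.neg_gcd]; exact_mod_cast hc)⟩
  · have hd := h.eight_dvd_of_odd (by rw [h.delta_eq_three (Or.inl rfl)]; decide) he
    have h1 := h.prime₂.one_lt
    have h8 : p₂ % 8 = 1 := by omega
    constructor
    · rw [jacobiSym.at_two hodd, ZMod.χ₈_nat_eq_if_mod_eight]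
      simp [h8, Nat.odd_iff.mp hodd]
    · rw [jacobiSym.at_neg_two hodd, ZMod.χ₈'_nat_eq_if_mod_eight]
      simp [h8, Nat.odd_iff.mp hodd]

/-- For odd primes 2a + 1 and 2b + 1, reciprocity gives (-1)^(abe). Since e · δ · gcd(6, ab) = 6,
exactly one of the three factors is even, so abe is even exactly when δ is odd. If one prime is 2,
then δ = 3 and both sides are 1. -/
lemma eps_mul_eps_pow (h : Admissible p₁ p₂ e δ) (hne : p₁ ≠ p₂) :
    (eps p₁ p₂ : ℂ) ^ e * (eps p₂ p₁ : ℂ) ^ e = (-1) ^ (δ + 1) := by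
  by_cases h₁ : p₁ = 2
  · subst h₁
    rw [h.delta_eq_three (Or.inl rfl), eps, eps, if_neg (Ne.symm hne), if_pos rfl]
    have := (h.jacobiSym_two_pow (Ne.symm hne)).1
    push_cast
    rw [this]
    norm_num
  by_cases h₂ : p₂ = 2
  · subst h₂
    rw [h.delta_eq_three (Or.inr rfl), eps, eps, if_neg hne, if_pos rfl]
    have := (h.symm.jacobiSym_two_pow hne).1
    push_cast
    rw [this]
    norm_num
  have o₁ := h.prime₁.odd_of_ne_two h₁
  have o₂ := h.prime₂.odd_of_ne_two h₂
  have hcop : (p₂ : ℤ).gcd p₁ = 1 := by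
    exact_mod_cast (Nat.coprime_primes h.prime₂ h.prime₁).mpr (Ne.symm hne)
  have hJ : (jacobiSym p₁ p₂ : ℂ) * jacobiSym p₂ p₁ = (-1) ^ (p₁ / 2 * (p₂ / 2)) := by
    rw [jacobiSym.quadratic_reciprocity o₁ o₂]
    have := jacobiSym.sq_one hcop
    push_cast
    rw [mul_assoc, ← pow_two]
    norm_cast
    rw [this]
    simp
  rw [← mul_pow, eps, eps, if_neg h₁, if_neg h₂, hJ, ← pow_mul, neg_one_pow_congr]
  obtain ⟨a, rfl⟩ := o₁
  obtain ⟨b, rfl⟩ := o₂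
  have ea : (2 * a + 1) / 2 = a := by omega
  have eb : (2 * b + 1) / 2 = b := by omega
  rw [ea, eb]
  have hg := h.mul_gcd
  rw [Nat.add_sub_cancel, Nat.add_sub_cancel, show 2 * a * (2 * b) = 4 * (a * b) by ring,
    show 24 = 4 * 6 by norm_num, Nat.gcd_mul_left] at hg
  have hg6 : e * δ * Nat.gcd 6 (a * b) = 6 := by linarith
  have hedvd := Nat.gcd_dvd_right 6 (a * b)
  generalize hG : Nat.gcd 6 (a * b) = G at hg6 hedvd
  have hnot : ∀ x y : ℕ, x * y = 6 → ¬ (Even x ∧ Even y) := by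
    rintro x y hxy ⟨⟨m, rfl⟩, ⟨n, rfl⟩⟩
    have : 4 * (m * n) = 6 := by linarith
    omega
  have hsix : Even (e * δ * G) := by rw [hg6]; decide
  rw [Nat.even_mul, Nat.even_mul] at hsix
  have k1 := hnot (e * δ) G hg6
  have k2 := hnot e (δ * G) (by linarith)
  rw [Nat.even_mul] at k1 k2
  have k3 : Even G ↔ Even (a * b) := by
    refine ⟨fun hG2 => even_iff_two_dvd.mpr ((even_iff_two_dvd.mp hG2).trans hedvd), fun hab => ?_⟩
    rw [← hG]
    exact even_iff_two_dvd.mpr (Nat.dvd_gcd (by norm_num) (even_iff_two_dvd.mp hab))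
  rw [Nat.even_mul, Nat.even_add_one]
  tauto

/-- For p > 3 already 24 ∣ p² - 1. For p = 2 and p = 3 the admissible e are forced to be 8 and 3,
which supply the missing factor. -/
lemma twentyfour_dvd_of_eq {p : ℕ} (h : Admissible p p e δ) : (24 : ℤ) ∣ e * ((p : ℤ) ^ 2 - 1) := by
  by_cases h2 : p = 2
  · subst h2
    have := h.mul_gcd
    rw [h.delta_eq_three (Or.inl rfl)] at this
    simp at this
    obtain rfl : e = 8 := by omega
    norm_num
  by_cases h3 : p = 3
  · subst h3
    have hδ : δ = 2 := by
      have := h.mod_three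
      rcases h.delta_cases with rfl | rfl | rfl <;> omega
    have := h.mul_gcd
    rw [hδ] at this
    simp at this
    obtain rfl : e = 3 := by omega
    norm_num
  have hodd : Odd (p : ℤ) := by exact_mod_cast h.prime₁.odd_of_ne_two h2
  have hc : IsCoprime (24 : ℤ) (p : ℤ) := by
    have k2 : Nat.Coprime 2 p := (Nat.coprime_primes Nat.prime_two h.prime₁).mpr (Ne.symm h2)
    have k3 : Nat.Coprime 3 p := (Nat.coprime_primes Nat.prime_three h.prime₁).mpr (Ne.symm h3)
    have : Nat.Coprime (2 ^ 3 * 3) p := (k2.pow_left 3).mul_left k3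
    exact_mod_cast Nat.isCoprime_iff_coprime.mpr this
  exact (hc.dvd_of_dvd_mul_left (twentyfour_dvd_cube_sub hodd)).mul_left _

end Admissible

/-! ### The twisted conjugates, indexed by integers -/

lemma w_comm (p q : ℕ) (z : ℂ) : w p q z = w q p z := by
  rw [w, w, mul_comm (eta (z / p)), mul_comm (p : ℂ)]

/-- The quotient of four values of `η` in the definition of `C`. -/
noncomputable def rawC (p q : ℕ) (z : ℂ) : ℂ :=
  eta (p * z) * eta (z / q) / (eta z * eta (p * z / q))

/-- `A'` with integer index. -/
noncomputable def twA (p q e δ : ℕ) (n : ℤ) (z : ℂ) : ℂ :=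
  chi p q e ^ (alpha0 δ - n) * w p q (z + n) ^ e

/-- `C₁'` and `C₂'` with integer index, in which the exponents `θ` cancel. -/
noncomputable def twC (p q e : ℕ) (n : ℤ) (z : ℂ) : ℂ :=
  chi p q e ^ (-n) * (eps p q : ℂ) ^ e * rawC p q (z + n) ^ e

lemma twA_comm (p q e δ : ℕ) (n : ℤ) (z : ℂ) : twA p q e δ n z = twA q p e δ n z := by
  rw [twA, twA, chi_comm, w_comm]

lemma A'_eq_twA (p q e ν : ℕ) (z : ℂ) : A' p q e ν z = twA p q e (s p q / e) ν z := by
  rw [A', A, twA, Int.cast_natCast]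

/-- Because χ = φ^(-e), the twist χ^θ cancels the e-th power of φ^θ; the values of θ, u and v play
no further role. -/
lemma twisted_C_eq_twC (p q e : ℕ) (u v : ℤ) (ν : ℕ) (z : ℂ) :
    chi p q e ^ (theta p q u v ν - ν) * C p q u v ν z ^ e = twC p q e ν z := by
  have h : chi p q e ^ theta p q u v ν * (phi p q ^ theta p q u v ν) ^ e = 1 := by
    rw [chi, ← zpow_mul, ← zpow_natCast, ← zpow_mul, ← zpow_add₀ (phi_ne_zero _ _)]
    rw [show -(e : ℤ) * theta p q u v ν + theta p q u v ν * e = 0 by ring, zpow_zero]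
  rw [C, twC, sub_eq_add_neg, zpow_add₀ (chi_ne_zero _ _ _), mul_pow, mul_pow, rawC,
    Int.cast_natCast]
  linear_combination (chi p q e ^ (-(ν : ℤ)) * (eps p q : ℂ) ^ e * (eta (p * (z + ν)) * eta ((z + ν) / q) /
      (eta (z + ν) * eta (p * (z + ν) / q))) ^ e) * h

lemma C₂'_eq_twC (p₁ p₂ e : ℕ) (u v : ℤ) (ν : ℕ) (z : ℂ) :
    C₂' p₁ p₂ e u v ν z = twC p₁ p₂ e ν z := twisted_C_eq_twC _ _ _ _ _ _ _

lemma C₁'_eq_twC (p₁ p₂ e : ℕ) (u v : ℤ) (ν : ℕ) (z : ℂ) :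
    C₁' p₁ p₂ e u v ν z = twC p₂ p₁ e ν z := by
  rw [C₁', chi_comm]
  exact twisted_C_eq_twC _ _ _ _ _ _ _

/-! ### Translations -/

/-- Bookkeeping for four applications of the η law: j is a symbol, t^x a root of unity, r a square
root and h an η-value. -/
lemma eta_quotient_mul {t j₁ j₂ j₃ j₄ r₁ r₂ r₃ r₄ h₁ h₂ h₃ h₄ ε : ℂ} {x₁ x₂ x₃ x₄ : ℤ} (ht : t ≠ 0)
    (hj : j₁ * j₂ = ε * (j₃ * j₄)) (hj₀ : j₃ * j₄ ≠ 0) (hr : r₁ * r₂ = r₃ * r₄)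
    (hr₀ : r₃ * r₄ ≠ 0) :
    (j₁ * t ^ x₁ * r₁ * h₁) * (j₂ * t ^ x₂ * r₂ * h₂) /
      ((j₃ * t ^ x₃ * r₃ * h₃) * (j₄ * t ^ x₄ * r₄ * h₄)) =
      ε * t ^ (x₁ + x₂ - (x₃ + x₄)) * (h₁ * h₂ / (h₃ * h₄)) := by
  have e₁ : (j₁ * t ^ x₁ * r₁ * h₁) * (j₂ * t ^ x₂ * r₂ * h₂) =
      (ε * t ^ (x₁ + x₂) * (h₁ * h₂)) * ((j₃ * j₄) * (r₃ * r₄)) := by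
    rw [zpow_add₀ ht, ← hr]
    linear_combination (t ^ x₁ * t ^ x₂ * r₁ * r₂ * h₁ * h₂) * hj
  have e₂ : (j₃ * t ^ x₃ * r₃ * h₃) * (j₄ * t ^ x₄ * r₄ * h₄) =
      (t ^ (x₃ + x₄) * (h₃ * h₄)) * ((j₃ * j₄) * (r₃ * r₄)) := by
    rw [zpow_add₀ ht]
    ring
  rw [e₁, e₂, mul_div_mul_right _ _ (mul_ne_zero hj₀ hr₀), zpow_sub₀ ht, mul_div_mul_comm,
    mul_div_assoc ε]

lemma eta_quotient_mul' {t h₁ h₂ h₃ h₄ : ℂ} {x₁ x₂ x₃ x₄ : ℤ} (ht : t ≠ 0) :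
    (t ^ x₁ * h₁) * (t ^ x₂ * h₂) / ((t ^ x₃ * h₃) * (t ^ x₄ * h₄)) =
      t ^ (x₁ + x₂ - (x₃ + x₄)) * (h₁ * h₂ / (h₃ * h₄)) := by
  have := eta_quotient_mul (j₁ := 1) (j₂ := 1) (j₃ := 1) (j₄ := 1) (r₁ := 1) (r₂ := 1) (r₃ := 1)
    (r₄ := 1) (ε := 1) (h₁ := h₁) (h₂ := h₂) (h₃ := h₃) (h₄ := h₄) (x₁ := x₁) (x₂ := x₂)
    (x₃ := x₃) (x₄ := x₄) ht (by ring) (by simp) rfl (by simp)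
  simpa using this

lemma w_add_mul {p q : ℕ} (hp : 0 < p) (hq : 0 < q) (z : ℂ) :
    w p q (z + (p * q : ℕ)) = zeta 24 ^ (((p : ℤ) - 1) * (q - 1) * (-1)) * w p q z := by
  have hp0 : (p : ℂ) ≠ 0 := by exact_mod_cast hp.ne'
  have hq0 : (q : ℂ) ≠ 0 := by exact_mod_cast hq.ne'
  have e₁ : (z + (p * q : ℕ)) / p = z / p + (q : ℤ) := by push_cast; field_simp
  have e₂ : (z + (p * q : ℕ)) / q = z / q + (p : ℤ) := by push_cast; field_simp
  have e₃ : (z + (p * q : ℕ)) / (p * q) = z / (p * q) + (1 : ℤ) := by push_cast; field_simp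
  have e₄ : z + (p * q : ℕ) = z + ((p * q : ℤ) : ℂ) := by push_cast; ring
  rw [w, w, e₁, e₂, e₃, e₄, eta_add_int, eta_add_int, eta_add_int, eta_add_int,
    eta_quotient_mul' (zeta_ne_zero _)]
  congr 2
  ring

lemma rawC_add_right {p q : ℕ} (hq : 0 < q) (z : ℂ) :
    rawC p q (z + q) = zeta 24 ^ (((p : ℤ) - 1) * (q - 1) * 1) * rawC p q z := by
  have hq0 : (q : ℂ) ≠ 0 := by exact_mod_cast hq.ne'
  have e₁ : (p : ℂ) * (z + q) = p * z + ((p * q : ℤ) : ℂ) := by push_cast; ring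
  have e₂ : (z + q) / q = z / q + (1 : ℤ) := by push_cast; field_simp
  have e₃ : (p : ℂ) * (z + q) / q = p * z / q + (p : ℤ) := by push_cast; field_simp
  have e₄ : z + q = z + ((q : ℤ) : ℂ) := by push_cast; ring
  rw [rawC, rawC, e₂, e₃, e₁, e₄, eta_add_int, eta_add_int, eta_add_int, eta_add_int,
    eta_quotient_mul' (zeta_ne_zero _)]
  congr 2
  ring

namespace Admissible

variable {p q e δ : ℕ}

lemma delta_dvd_mul_sub_one (h : Admissible p q e δ) : (δ : ℤ) ∣ (p : ℤ) * q - 1 := by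
  have := (Nat.modEq_iff_dvd.mp h.modEq.symm)
  push_cast at this
  exact this

lemma delta_dvd_succ_int (h : Admissible p q e δ) : (δ : ℤ) ∣ (p : ℤ) + 1 := by
  exact_mod_cast h.delta_dvd_succ

lemma delta_dvd_six (h : Admissible p q e δ) : (δ : ℤ) ∣ 6 := (delta_dvd_three h.delta_cases).2

lemma delta_dvd_alpha0 (h : Admissible p q e δ) : (δ : ℤ) ∣ alpha0 δ + 3 :=
  (delta_dvd_three h.delta_cases).1

lemma zeta_zpow (h : Admissible p q e δ) (n : ℤ) :
    (zeta 24 ^ (((p : ℤ) - 1) * (q - 1) * n)) ^ e = chi p q e ^ (-n) :=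
  zeta_zpow_eq_chi p q e h.prime₁.one_lt.le h.prime₂.one_lt.le n

lemma chi_zpow_alpha0_mul_self (h : Admissible p q e δ) :
    chi p q e ^ alpha0 δ * chi p q e ^ alpha0 δ = 1 := by
  rw [h.chi_zpow_alpha0, ← mul_pow]
  simp

/-- A shift by N costs χ from the η-quotient and χ^(-N) from the twist; these cancel because N ≡ 1
modulo δ. -/
lemma twA_periodic (h : Admissible p q e δ) (z : ℂ) :
    Function.Periodic (fun n : ℤ => twA p q e δ n z) ((p * q : ℕ) : ℤ) := by
  intro n
  have e₁ : z + ((n + ((p * q : ℕ) : ℤ) : ℤ) : ℂ) = z + n + (p * q : ℕ) := by push_cast; ring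
  simp only [twA]
  rw [e₁, w_add_mul h.prime₁.pos h.prime₂.pos, mul_pow, h.zeta_zpow, ← mul_assoc,
    ← zpow_add₀ (chi_ne_zero _ _ _)]
  congr 1
  apply h.chi_zpow_congr
  obtain ⟨t, ht⟩ := h.delta_dvd_mul_sub_one
  exact ⟨-t, by push_cast; linear_combination -ht⟩

lemma twC_periodic (h : Admissible p q e δ) (z : ℂ) :
    Function.Periodic (fun n : ℤ => twC p q e n z) (q : ℤ) := by
  intro n
  have e₁ : z + ((n + (q : ℤ) : ℤ) : ℂ) = z + n + q := by push_cast; ring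
  simp only [twC]
  rw [e₁, rawC_add_right h.prime₂.pos, mul_pow, h.zeta_zpow]
  -- Here the quotient contributes χ⁻¹ and the twist χ^(-q), so q ≡ -1 modulo δ is what is needed.
  have : chi p q e ^ (-(n + (q : ℤ))) * chi p q e ^ (-1 : ℤ) = chi p q e ^ (-n) := by
    rw [← zpow_add₀ (chi_ne_zero _ _ _)]
    apply h.chi_zpow_congr
    obtain ⟨t, ht⟩ := h.symm.delta_dvd_succ_int
    exact ⟨-t, by linear_combination -ht⟩
  rw [← this]
  ring

lemma eps_sq (h : Admissible p q e δ) (hne : p ≠ q) : (eps p q : ℂ) ^ 2 = 1 := by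
  rw [eps]
  split_ifs
  · simp
  · have hcop : (p : ℤ).gcd q = 1 := by
      exact_mod_cast (Nat.coprime_primes h.prime₁ h.prime₂).mpr hne
    exact_mod_cast jacobiSym.sq_one hcop

end Admissible

lemma twA_add_one (p q e δ : ℕ) (n : ℤ) (z : ℂ) :
    twA p q e δ n (z + 1) = chi p q e * twA p q e δ (n + 1) z := by
  rw [twA, twA, ← mul_assoc, ← zpow_one_add₀ (chi_ne_zero _ _ _)]
  push_cast
  congr 2
  · ring
  · congr 1
    ring

lemma twC_add_one (p q e : ℕ) (n : ℤ) (z : ℂ) :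
    twC p q e n (z + 1) = chi p q e * twC p q e (n + 1) z := by
  rw [twC, twC, ← mul_assoc, ← mul_assoc, ← zpow_one_add₀ (chi_ne_zero _ _ _)]
  push_cast
  congr 2
  · congr 2
    ring
  · congr 1
    ring

lemma Admissible.B'_add_one {p q e δ : ℕ} (h : Admissible p q e δ) (z : ℂ) :
    B' p q e (z + 1) = chi p q e * B' p q e z := by
  have e₁ : (p : ℂ) * (z + 1) = p * z + (p : ℤ) := by push_cast; ring
  have e₂ : (q : ℂ) * (z + 1) = q * z + (q : ℤ) := by push_cast; ring
  have e₃ : (p : ℂ) * q * (z + 1) = p * q * z + ((p * q : ℤ) : ℂ) := by push_cast; ring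
  have e₄ : z + 1 = z + ((1 : ℤ) : ℂ) := by push_cast; ring
  rw [B', B', B, B, e₁, e₂, e₃, e₄, eta_add_int, eta_add_int, eta_add_int, eta_add_int,
    eta_quotient_mul' (zeta_ne_zero _), mul_pow]
  congr 1
  rw [show (p : ℤ) + q - (1 + p * q) = ((p : ℤ) - 1) * (q - 1) * (-1) by ring, h.zeta_zpow]
  simp

lemma Admissible.CEq'_add_one {p e δ : ℕ} (h : Admissible p p e δ) (ν : ℕ) (z : ℂ) :
    CEq' p e ν (z + 1) = chi p p e * CEq' p e ν z := by
  have e₁ : (p : ℂ) * (z + 1) = p * z + (p : ℤ) := by push_cast; ring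
  have e₂ : z + 1 + (ν : ℂ) / p = z + ν / p + (1 : ℤ) := by push_cast; ring
  have e₄ : z + 1 = z + ((1 : ℤ) : ℂ) := by push_cast; ring
  -- The exponent 2(p - 1) equals (p² - 1) - (p - 1)², and the first term disappears after
  -- multiplication by e.
  have hχ : (zeta 24 ^ ((p : ℤ) + p - (1 + 1))) ^ e = chi p p e := by
    have h1 := h.zeta_zpow (-1)
    rw [neg_neg, zpow_one] at h1
    rw [← h1, ← zpow_natCast, ← zpow_natCast, ← zpow_mul, ← zpow_mul]
    apply zeta_zpow_congr
    obtain ⟨t, ht⟩ := h.twentyfour_dvd_of_eq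
    exact ⟨t, by linear_combination ht⟩
  rw [CEq', CEq', CEq, CEq, e₂, e₁, e₄, eta_add_int, eta_add_int, eta_add_int, pow_two,
    eta_quotient_mul' (zeta_ne_zero _), ← pow_two, mul_left_comm (_ * _ * _), mul_pow, hχ]
  ring

/-! ### Inversion -/

lemma eta_mul_neg_one_div {t : ℝ} (ht : 0 < t) {z : ℂ} (hz : 0 < z.im) :
    eta (t * (-1 / z)) = Real.sqrt t⁻¹ * rootI z * eta ((t⁻¹ : ℝ) * z) := by
  have hz0 : z ≠ 0 := fun h => by simp [h] at hz
  have ht0 : (t : ℂ) ≠ 0 := by exact_mod_cast ht.ne'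
  have h1 : (0 : ℝ) < (((t⁻¹ : ℝ) : ℂ) * z).im := by
    rw [Complex.im_ofReal_mul]
    exact mul_pos (inv_pos.mpr ht) hz
  rw [← rootI_ofReal_mul (inv_pos.mpr ht) hz, ← eta_neg_one_div h1]
  congr 1
  push_cast
  field_simp

lemma natCast_mul_im_pos {p : ℕ} (hp : 0 < p) {z : ℂ} (hz : 0 < z.im) :
    0 < ((p : ℂ) * z).im := by
  have : (0 : ℝ) < p := by exact_mod_cast hp
  rw [← Complex.ofReal_natCast, Complex.im_ofReal_mul]
  exact mul_pos this hz

lemma w_neg_one_div {p q : ℕ} (hp : 0 < p) (hq : 0 < q) {z : ℂ} (hz : 0 < z.im) :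
    w p q (-1 / z) = B p q z := by
  have hp' : (0 : ℝ) < p := by exact_mod_cast hp
  have hq' : (0 : ℝ) < q := by exact_mod_cast hq
  have h₁ := eta_mul_neg_one_div (inv_pos.mpr hp') hz
  have h₂ := eta_mul_neg_one_div (inv_pos.mpr hq') hz
  have h₃ := eta_mul_neg_one_div (inv_pos.mpr (mul_pos hp' hq')) hz
  simp only [inv_inv] at h₁ h₂ h₃
  have e₁ : (-1 / z) / p = ((p : ℝ)⁻¹ : ℝ) * (-1 / z) := by push_cast; ring
  have e₂ : (-1 / z) / q = ((q : ℝ)⁻¹ : ℝ) * (-1 / z) := by push_cast; ring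
  have e₃ : (-1 / z) / (p * q) = ((p * q : ℝ)⁻¹ : ℝ) * (-1 / z) := by push_cast; ring
  have hr := rootI_ne_zero hz
  have s₁ : ((Real.sqrt p : ℝ) : ℂ) ≠ 0 := by exact_mod_cast (Real.sqrt_pos.mpr hp').ne'
  have s₂ : ((Real.sqrt q : ℝ) : ℂ) ≠ 0 := by exact_mod_cast (Real.sqrt_pos.mpr hq').ne'
  rw [w, B, e₁, e₂, e₃, h₁, h₂, h₃, eta_neg_one_div hz, Real.sqrt_mul hp'.le, mul_comm (eta z)]
  push_cast
  rw [show (Real.sqrt p : ℂ) * rootI z * eta (p * z) * (Real.sqrt q * rootI z * eta (q * z)) =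
      (Real.sqrt p * Real.sqrt q * rootI z * rootI z) * (eta (p * z) * eta (q * z)) by ring,
    show (Real.sqrt p : ℂ) * Real.sqrt q * rootI z * eta (p * q * z) * (rootI z * eta z) =
      (Real.sqrt p * Real.sqrt q * rootI z * rootI z) * (eta (p * q * z) * eta z) by ring,
    mul_div_mul_left _ _ (by simp [s₁, s₂, hr])]

lemma rawC_neg_one_div {p q : ℕ} (hp : 0 < p) (hq : 0 < q) {z : ℂ} (hz : 0 < z.im) :
    rawC p q (-1 / z) = rawC q p z := by
  have hp' : (0 : ℝ) < p := by exact_mod_cast hp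
  have hq' : (0 : ℝ) < q := by exact_mod_cast hq
  have h₁ := eta_mul_neg_one_div hp' hz
  have h₂ := eta_mul_neg_one_div (inv_pos.mpr hq') hz
  have h₃ := eta_mul_neg_one_div (div_pos hp' hq') hz
  have e₁ : (p : ℂ) * (-1 / z) = (p : ℝ) * (-1 / z) := by push_cast; ring
  have e₂ : (-1 / z) / q = ((q : ℝ)⁻¹ : ℝ) * (-1 / z) := by push_cast; ring
  have e₃ : p * (-1 / z) / q = ((p / q : ℝ) : ℝ) * (-1 / z) := by push_cast; ring
  have e₄ : ((((p : ℝ) / q)⁻¹ : ℝ) : ℂ) * z = q * z / p := by push_cast; rw [inv_div]; ring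
  have e₅ : (((p : ℝ)⁻¹ : ℝ) : ℂ) * z = z / p := by push_cast; ring
  have hr := rootI_ne_zero hz
  have s₁ : ((Real.sqrt p : ℝ) : ℂ) ≠ 0 := by exact_mod_cast (Real.sqrt_pos.mpr hp').ne'
  have s₂ : ((Real.sqrt q : ℝ) : ℂ) ≠ 0 := by exact_mod_cast (Real.sqrt_pos.mpr hq').ne'
  have hs : Real.sqrt ((p : ℝ) / q)⁻¹ = Real.sqrt ((p : ℝ)⁻¹) * Real.sqrt q := by
    rw [inv_div, div_eq_mul_inv, mul_comm, Real.sqrt_mul (inv_pos.mpr hp').le]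
  have s₃ : ((Real.sqrt ((p : ℝ)⁻¹) : ℝ) : ℂ) ≠ 0 := by
    exact_mod_cast (Real.sqrt_pos.mpr (inv_pos.mpr hp')).ne'
  rw [rawC, rawC, e₃, e₁, e₂, h₁, h₂, h₃, eta_neg_one_div hz, inv_inv, hs, e₄, e₅]
  push_cast
  rw [show (Real.sqrt ((p : ℝ)⁻¹) : ℂ) * rootI z * eta (z / p) * (Real.sqrt q * rootI z * eta (q * z)) =
      (Real.sqrt ((p : ℝ)⁻¹) * Real.sqrt q * rootI z * rootI z) * (eta (q * z) * eta (z / p)) by ring,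
    show rootI z * eta z * (Real.sqrt ((p : ℝ)⁻¹) * Real.sqrt q * rootI z * eta (q * z / p)) =
      (Real.sqrt ((p : ℝ)⁻¹) * Real.sqrt q * rootI z * rootI z) * (eta z * eta (q * z / p)) by ring,
    mul_div_mul_left _ _ (by simp only [ne_eq, mul_eq_zero, s₃, s₂, hr, or_self, not_false_iff])]

/-- At the point (z - d)/m the automorphy factor is z whatever the matrix, so the square roots
coming from different matrices coincide. -/
lemma inversion_shift {m : ℕ} (hm : 0 < m) {a b d : ℤ} (h : a * d - b * m = 1) {z : ℂ}
    (hz : z ≠ 0) :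
    ((a : ℂ) * ((z - d) / m) + b) / ((m : ℤ) * ((z - d) / m) + d) = (-1 / z + a) / m := by
  have hm0 : (m : ℂ) ≠ 0 := by exact_mod_cast hm.ne'
  have h' : (a : ℂ) * d - b * m = 1 := by exact_mod_cast h
  have e : ((m : ℤ) : ℂ) * ((z - d) / m) + d = z := by push_cast; field_simp; ring
  rw [e]
  field_simp
  linear_combination -h'

lemma eta_inversion_odd_left {m : ℕ} (hm : Odd m) {a b d : ℤ} (h : a * d - b * m = 1) {z : ℂ}
    (hz : 0 < z.im) :
    eta ((-1 / z + a) / m) =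
      jacobiSym d m * zeta 24 ^ etaExp a b m d * rootI z * eta ((z - d) / m) := by
  have hm0 : (m : ℂ) ≠ 0 := by exact_mod_cast hm.pos.ne'
  have hz0 : z ≠ 0 := fun h => by simp [h] at hz
  have e : ((m : ℤ) : ℂ) * ((z - d) / m) + d = z := by push_cast; field_simp; ring
  have hi : 0 < ((z - d) / m).im := by
    have : (0 : ℝ) < m := by exact_mod_cast hm.pos
    rw [Complex.div_natCast_im]
    exact div_pos (by simpa using hz) this
  have := etaLaw m hm a b d h _ hi
  rwa [inversion_shift hm.pos h hz0, e] at this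

lemma eta_inversion_odd_right {m d : ℕ} (hm : 0 < m) (hd : Odd d) {a b : ℤ}
    (h : a * d - b * m = 1) {z : ℂ} (hz : 0 < z.im) :
    eta ((-1 / z + a) / m) =
      jacobiSym (-m) d * zeta 24 ^ (etaExp b (-a) d (-m) + 3) * rootI z * eta ((z - (d : ℤ)) / m) := by
  have hm0 : (m : ℂ) ≠ 0 := by exact_mod_cast hm.ne'
  have hz0 : z ≠ 0 := fun h => by simp [h] at hz
  have e : ((m : ℤ) : ℂ) * ((z - (d : ℤ)) / m) + (d : ℤ) = z := by push_cast; field_simp; ring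
  have hi : 0 < ((z - (d : ℤ)) / m).im := by
    have : (0 : ℝ) < m := by exact_mod_cast hm
    rw [Complex.div_natCast_im]
    exact div_pos (by simpa using hz) this
  have := eta_law_of_odd_right hm hd h hi
  rwa [inversion_shift hm h hz0, e] at this

/-- The factor 1 holds the place of the Jacobi symbol, to fit the shape required by
`eta_quotient_mul`. -/
lemma eta_inversion_int (a d : ℤ) {z : ℂ} (hz : 0 < z.im) :
    eta (-1 / z + a) = 1 * zeta 24 ^ (a + d) * rootI z * eta (z - d) := by
  have h := eta_add_int (z - d) d
  rw [sub_add_cancel] at h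
  rw [eta_add_int, eta_neg_one_div hz, h, zpow_add₀ (zeta_ne_zero _)]
  ring

namespace Admissible

variable {p q e δ : ℕ}

lemma B'_neg_one_div (h : Admissible p q e δ) {z : ℂ} (hz : 0 < z.im) :
    B' p q e (-1 / z) = chi p q e ^ alpha0 δ * twA p q e δ 0 z := by
  have h1 := w_neg_one_div h.prime₁.pos h.prime₂.pos (neg_one_div_im_pos hz)
  have hz0 : z ≠ 0 := fun h => by simp [h] at hz
  have e1 : -1 / (-1 / z) = z := by field_simp
  rw [e1] at h1
  rw [B', ← h1, twA, sub_zero, ← mul_assoc, h.chi_zpow_alpha0_mul_self, Int.cast_zero, add_zero,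
    one_mul]

lemma twA_zero_neg_one_div (h : Admissible p q e δ) {z : ℂ} (hz : 0 < z.im) :
    twA p q e δ 0 (-1 / z) = chi p q e ^ alpha0 δ * B' p q e z := by
  rw [twA, Int.cast_zero, add_zero, w_neg_one_div h.prime₁.pos h.prime₂.pos hz, sub_zero, B']

lemma twC_zero_neg_one_div (h : Admissible p q e δ) (hne : p ≠ q) {z : ℂ} (hz : 0 < z.im) :
    twC p q e 0 (-1 / z) = chi p q e ^ alpha0 δ * twC q p e 0 z := by
  have h1 := h.eps_mul_eps_pow hne
  have h2 := h.symm.eps_sq (Ne.symm hne)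
  have h3 : ((eps q p : ℂ) ^ e) * (eps q p : ℂ) ^ e = 1 := by
    rw [← mul_pow, ← pow_two, h2, one_pow]
  rw [twC, twC, Int.cast_zero, add_zero, add_zero, rawC_neg_one_div h.prime₁.pos h.prime₂.pos hz,
    h.chi_zpow_alpha0, neg_zero, zpow_zero, zpow_zero, ← h1]
  linear_combination (-(eps p q : ℂ) ^ e * rawC q p z ^ e) * h3

/-- The image of `A'_ν` under inversion, for `ν` prime to `p q`. -/
lemma twA_neg_one_div_of_unit (h : Admissible p q e δ) {ν K : ℤ} {d : ℕ} (hd : Odd d)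
    (hK : ν * d + K * (p * q) = 1) {z : ℂ} (hz : 0 < z.im) :
    twA p q e δ ν (-1 / z) = chi p q e ^ alpha0 δ * twA p q e δ (-d) z := by
  have hp := h.prime₁.pos
  have hq := h.prime₂.pos
  -- With d odd, a single form of the law serves all four moduli p, q, pq and 1, even if a prime is
  -- 2.
  have h₁ := eta_inversion_odd_right (a := ν) (b := -(K * q)) hp hd (by linear_combination hK) hz
  have h₂ := eta_inversion_odd_right (a := ν) (b := -(K * p)) hq hd (by linear_combination hK) hz
  have h₃ := eta_inversion_odd_right (m := p * q) (a := ν) (b := -K) (Nat.mul_pos hp hq) hd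
    (by push_cast; linear_combination hK) hz
  have h₄ := eta_inversion_odd_right (m := 1) (a := ν) (b := -(K * (p * q))) one_pos hd
    (by push_cast; linear_combination hK) hz
  have hJ₁ : (p : ℤ).gcd d = 1 := Int.isCoprime_iff_gcd_eq_one.mp
    ⟨K * q, ν, by linear_combination hK⟩
  have hJ₂ : (q : ℤ).gcd d = 1 := Int.isCoprime_iff_gcd_eq_one.mp
    ⟨K * p, ν, by linear_combination hK⟩
  have j₀ : jacobiSym (-(p * q : ℕ)) d * jacobiSym (-(1 : ℕ)) d =
      jacobiSym p d * jacobiSym q d := by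
    rw [← jacobiSym.mul_left, ← jacobiSym.mul_left]
    congr 1
    push_cast
    ring
  have j₁ : jacobiSym (-p) d * jacobiSym (-q) d = jacobiSym p d * jacobiSym q d := by
    rw [← jacobiSym.mul_left, ← jacobiSym.mul_left]
    congr 1
    ring
  have hr := rootI_ne_zero hz
  have key : w p q (-1 / z + ν) =
      zeta 24 ^ (((p : ℤ) - 1) * (q - 1) * ((K + 1) * d + ν * (d ^ 2 - 1))) *
        w p q (z + ((-d : ℤ) : ℂ)) := by
    have e₁ : z + ((-d : ℤ) : ℂ) = z - (d : ℤ) := by push_cast; ring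
    rw [Nat.cast_one, div_one, div_one] at h₄
    rw [Nat.cast_mul] at h₃
    rw [e₁, w, w, h₁, h₂, h₃, h₄,
      eta_quotient_mul (ε := 1) (zeta_ne_zero _) _ _ rfl (mul_ne_zero hr hr), one_mul]
    · congr 2
      simp only [etaExp]
      push_cast
      ring
    · rw [one_mul]
      exact_mod_cast j₁.trans j₀.symm
    · have := mul_ne_zero (jacobiSym.ne_zero hJ₁) (jacobiSym.ne_zero hJ₂)
      rw [← j₀] at this
      exact_mod_cast this
  rw [twA, twA, key, mul_pow, h.zeta_zpow, ← mul_assoc, ← mul_assoc,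
    ← zpow_add₀ (chi_ne_zero _ _ _), ← zpow_add₀ (chi_ne_zero _ _ _)]
  congr 1
  apply h.chi_zpow_congr
  obtain ⟨t, ht⟩ := h.delta_dvd_mul_sub_one
  obtain ⟨x, hx⟩ := h.delta_dvd_alpha0
  obtain ⟨y, hy⟩ := h.delta_dvd_six
  obtain ⟨r, rfl⟩ := hd
  -- Modulo δ one has νd ≡ 1 - K, which reduces the exponent on the left to α₀ - 2d. The right side
  -- is 2α₀ + d, and -3d ≡ -3 ≡ α₀ because d is odd and δ ∣ 6.
  refine ⟨(2 * r + 1) * K * t - x - y * r, ?_⟩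
  push_cast at hK ⊢
  linear_combination (-(2 * (r : ℤ) + 1)) * hK + (2 * (r : ℤ) + 1) * K * ht - hx - (r : ℤ) * hy

/-- The image of `A'_{pj}` under inversion, for odd `q`. -/
lemma twA_mul_neg_one_div_of_odd (h : Admissible p q e δ) (hne : p ≠ q) (hq : Odd q) {j n V : ℤ}
    (hV : q * V = 1 + n * j * p) {z : ℂ} (hz : 0 < z.im) :
    twA p q e δ (p * j) (-1 / z) = chi p q e ^ alpha0 δ * twC p q e n z := by
  have hp := h.prime₁.pos
  have hp0 : (p : ℂ) ≠ 0 := by exact_mod_cast hp.ne'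
  have hz0 : z ≠ 0 := fun h => by simp [h] at hz
  have hpz := natCast_mul_im_pos hp hz
  -- Since (-1/z + pj)/p = -1/(pz) + j, two of the four values are inverted at pz. Taking d = -pn
  -- there and d = -n at z produces the arguments of `rawC` at z + n.
  have h₁ := eta_inversion_int j (-(p * n)) hpz
  have h₂ := eta_inversion_odd_left (a := p * j) (b := -V) (d := -n) hq
    (by linear_combination hV) hz
  have h₃ := eta_inversion_odd_left (a := j) (b := -V) (d := -(p * n)) hq
    (by linear_combination hV) hpz
  have h₄ := eta_inversion_int (p * j) (-n) hz
  have hJp : (p : ℤ).gcd q = 1 := by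
    exact_mod_cast (Nat.coprime_primes h.prime₁ h.prime₂).mpr hne
  have hJ : (-(p * n) : ℤ).gcd q = 1 := Int.isCoprime_iff_gcd_eq_one.mp
    ⟨j, V, by linear_combination hV⟩
  have hj : jacobiSym (-n) q = jacobiSym p q * jacobiSym (-(p * n)) q := by
    rw [show (-(p * n) : ℤ) = p * (-n) by ring, jacobiSym.mul_left, ← mul_assoc, ← pow_two,
      jacobiSym.sq_one hJp, one_mul]
  have hr := rootI_ne_zero hz
  have hr' := rootI_ne_zero hpz
  have heps : eps p q = jacobiSym p q := by
    rw [eps, if_neg]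
    rintro rfl
    exact absurd hq (by decide)
  have e₁ : (-1 / z + ((p * j : ℤ) : ℂ)) / p = -1 / (p * z) + j := by
    push_cast; field_simp
  have e₃ : (-1 / z + ((p * j : ℤ) : ℂ)) / (p * q) = (-1 / (p * z) + j) / q := by
    rw [← e₁, div_div]
  have key : w p q (-1 / z + ((p * j : ℤ) : ℂ)) = (eps p q : ℂ) *
      zeta 24 ^ (((p : ℤ) - 1) * (q - 1) * (j + n + n * V * (q + 1))) * rawC p q (z + n) := by
    rw [w, e₁, e₃, h₁, h₂, h₃, h₄, eta_quotient_mul (ε := eps p q) (zeta_ne_zero _) _ _ rfl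
      (mul_ne_zero hr' hr), rawC]
    · congr 2
      · congr 1
        simp only [etaExp]
        ring
      · push_cast
        rw [sub_neg_eq_add, sub_neg_eq_add, mul_add]
      · push_cast
        rw [sub_neg_eq_add, sub_neg_eq_add, mul_add, mul_comm (eta (z + n))]
    · rw [one_mul, mul_one, heps]
      exact_mod_cast hj
    · rw [mul_one]
      exact_mod_cast jacobiSym.ne_zero hJ
  rw [twA, twC, key, mul_pow, mul_pow, h.zeta_zpow]
  have hx : chi p q e ^ (alpha0 δ - p * j) * chi p q e ^ (-(j + n + n * V * (q + 1))) =
      chi p q e ^ alpha0 δ * chi p q e ^ (-n) := by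
    rw [← zpow_add₀ (chi_ne_zero _ _ _), ← zpow_add₀ (chi_ne_zero _ _ _)]
    apply h.chi_zpow_congr
    obtain ⟨x, hx⟩ := h.delta_dvd_succ_int
    obtain ⟨y, hy⟩ := h.symm.delta_dvd_succ_int
    exact ⟨-j * x - n * V * y, by linear_combination -j * hx - n * V * hy⟩
  linear_combination (eps p q : ℂ) ^ e * rawC p q (z + n) ^ e * hx

/-- The image of `A'_{pj}` under inversion, for `q = 2`. -/
lemma twA_mul_neg_one_div_of_two (h : Admissible p 2 e δ) (hne : p ≠ 2) {j V : ℤ}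
    (hV : 2 * V = 1 - j * p) {z : ℂ} (hz : 0 < z.im) :
    twA p 2 e δ (p * j) (-1 / z) = chi p 2 e ^ alpha0 δ * twC p 2 e (-1) z := by
  have hp := h.prime₁.pos
  have hodd := h.prime₁.odd_of_ne_two hne
  have hp0 : (p : ℂ) ≠ 0 := by exact_mod_cast hp.ne'
  have hz0 : z ≠ 0 := fun h => by simp [h] at hz
  have hpz := natCast_mul_im_pos hp hz
  -- The lower left entry 2 is even, so the law for odd d is used. The representative n = -1 makes d
  -- equal to 1 and p, both odd; the symbol (-2/p) that remains disappears in the e-th power.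
  have h₁ := eta_inversion_int j p hpz
  have h₂ := eta_inversion_odd_right (m := 2) (a := p * j) (b := -V) (d := 1) two_pos odd_one
    (by push_cast; linear_combination hV) hz
  have h₃ := eta_inversion_odd_right (m := 2) (a := j) (b := -V) (d := p) two_pos hodd
    (by push_cast; linear_combination hV) hpz
  have h₄ := eta_inversion_int (p * j) 1 hz
  have hJ : (-(2 : ℕ) : ℤ).gcd p = 1 := by
    rw [Int.neg_gcd]
    exact_mod_cast (Nat.coprime_primes Nat.prime_two h.prime₁).mpr (Ne.symm hne)
  have hr := rootI_ne_zero hz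
  have hr' := rootI_ne_zero hpz
  have e₁ : (-1 / z + ((p * j : ℤ) : ℂ)) / p = -1 / (p * z) + j := by
    push_cast; field_simp
  have e₃ : (-1 / z + ((p * j : ℤ) : ℂ)) / (p * (2 : ℕ)) = (-1 / (p * z) + j) / (2 : ℕ) := by
    rw [← e₁, div_div]
  have key : w p 2 (-1 / z + ((p * j : ℤ) : ℂ)) = (jacobiSym (-2) p : ℂ) *
      zeta 24 ^ (((p : ℤ) - 1) * ((2 : ℕ) - 1) * (V + 6 - j + 2 * j * (p + 1))) *
        rawC p 2 (z + ((-1 : ℤ) : ℂ)) := by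
    rw [w, e₁, e₃, h₁, h₂, h₃, h₄, eta_quotient_mul (ε := jacobiSym (-2) p) (zeta_ne_zero _) _ _ rfl
      (mul_ne_zero hr' hr), rawC]
    · congr 2
      · congr 1
        simp only [etaExp]
        push_cast
        ring
      · push_cast
        rw [← sub_eq_add_neg, mul_sub, mul_one]
      · push_cast
        rw [← sub_eq_add_neg, mul_sub, mul_one, mul_comm (eta (z - 1))]
    · rw [jacobiSym.one_right, Int.cast_one, one_mul, mul_one, ← Int.cast_mul]
      have hJ2 := jacobiSym.sq_one hJ
      rw [pow_two] at hJ2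
      exact_mod_cast hJ2.symm
    · rw [mul_one]
      exact_mod_cast jacobiSym.ne_zero hJ
  rw [twA, twC, key, mul_pow, mul_pow, h.zeta_zpow, (h.symm.jacobiSym_two_pow hne).2]
  have hx : chi p 2 e ^ (alpha0 δ - p * j) * chi p 2 e ^ (-(V + 6 - j + 2 * j * (p + 1))) =
      chi p 2 e ^ alpha0 δ * chi p 2 e ^ (-(-1 : ℤ)) := by
    rw [← zpow_add₀ (chi_ne_zero _ _ _), ← zpow_add₀ (chi_ne_zero _ _ _)]
    apply h.chi_zpow_congr
    obtain ⟨x, hx⟩ := h.delta_dvd_succ_int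
    have h3 : (δ : ℤ) = 3 := by exact_mod_cast h.delta_eq_three (Or.inr rfl)
    rw [h3] at hx ⊢
    exact ⟨-4 * j * x + j - V - 2, by linear_combination -4 * j * hx + hV⟩
  rw [eps, if_pos rfl, Int.cast_one, one_pow]
  linear_combination rawC p 2 (z + ((-1 : ℤ) : ℂ)) ^ e * hx

/-- The image of `A'_{pj}` under inversion. -/
lemma twA_mul_neg_one_div (h : Admissible p q e δ) (hne : p ≠ q) {j n : ℤ}
    (hn : (q : ℤ) ∣ 1 + n * j * p) {z : ℂ} (hz : 0 < z.im) :
    twA p q e δ (p * j) (-1 / z) = chi p q e ^ alpha0 δ * twC p q e n z := by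
  by_cases h2 : q = 2
  · subst h2
    obtain ⟨V, hV⟩ := hn
    have hodd : Odd n := by
      rw [← Int.not_even_iff_odd]
      rintro ⟨r, rfl⟩
      have : 2 * (V - r * j * p) = 1 := by push_cast at hV; linear_combination -hV
      omega
    obtain ⟨r, rfl⟩ := hodd
    have hper : twC p 2 e (-1 + (r + 1) * ((2 : ℕ) : ℤ)) z = twC p 2 e (-1) z :=
      (h.twC_periodic z).int_mul (r + 1) (-1)
    rw [show (-1 : ℤ) + (r + 1) * ((2 : ℕ) : ℤ) = 2 * r + 1 by push_cast; ring] at hper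
    rw [hper]
    exact h.twA_mul_neg_one_div_of_two hne (V := V - (r + 1) * j * p)
      (by push_cast at hV; linear_combination -hV) hz
  · obtain ⟨V, hV⟩ := hn
    exact h.twA_mul_neg_one_div_of_odd hne (h.prime₂.odd_of_ne_two h2) hV.symm hz

/-- The image of `A'_{pμ}` under inversion, for equal primes. -/
lemma twA_eq_neg_one_div (h : Admissible p p e δ) {ν : ℕ}
    (hν : (p : ℤ) ∣ 1 + muEq p ν * ν) (hlt : ν < p) {z : ℂ} (hz : 0 < z.im) :
    twA p p e δ (p * muEq p ν) (-1 / z) = chi p p e ^ alpha0 δ * CEq' p e ν z := by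
  have hp := h.prime₁.pos
  have hpR : (0 : ℝ) < p := by exact_mod_cast hp
  have hp0 : (p : ℂ) ≠ 0 := by exact_mod_cast hp.ne'
  have hz0 : z ≠ 0 := fun h => by simp [h] at hz
  have hpz := natCast_mul_im_pos hp hz
  have hr := rootI_ne_zero hz
  have hroot : rootI (p * z) = Real.sqrt p * rootI z := by
    exact_mod_cast rootI_ofReal_mul hpR hz
  -- As p ≡ -1 modulo δ, the twist χ^(α₀ - pμ) is already χ^α₀ χ^μ; no further power of χ may arise
  -- from the η-quotient.
  suffices key : w p p (-1 / z + ((p * muEq p ν : ℤ) : ℂ)) ^ e = CEq p ν z ^ e by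
    rw [twA, key, CEq', ← mul_assoc, ← zpow_natCast (chi p p e), ← zpow_add₀ (chi_ne_zero _ _ _)]
    congr 1
    apply h.chi_zpow_congr
    obtain ⟨x, hx⟩ := h.delta_dvd_succ_int
    exact ⟨-muEq p ν * x, by linear_combination (-(muEq p ν : ℤ)) * hx⟩
  by_cases h2 : p = 2
  · subst h2
    have hν1 : ν = 1 := by
      have hcases : ν = 0 ∨ ν = 1 := by omega
      rcases hcases with rfl | rfl
      · norm_num at hν
      · rfl
    subst hν1
    have hμ : muEq 2 1 = 1 := by
      rw [muEq, Nat.cast_one, inv_one]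
      rfl
    have h₁ := eta_inversion_int 1 0 hpz
    have h₃ := eta_inversion_odd_right (m := 2) (a := 1) (b := 0) (d := 1) two_pos odd_one
      (by norm_num) hpz
    have h₄ := eta_inversion_int (((2 : ℕ) : ℤ) * ((1 : ℕ) : ℤ)) 0 hz
    -- Inversion with d = 1 ends at z - 1/2, whereas C_1 has η(z + 1/2).
    have hshift := eta_add_int (z - 1 / 2) 1
    rw [jacobiSym.one_right] at h₃
    have e₁ : (-1 / z + (((2 : ℕ) * (1 : ℕ) : ℤ) : ℂ)) / (2 : ℕ) = -1 / ((2 : ℕ) * z) + (1 : ℤ) := by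
      push_cast; field_simp
    have e₃ : (-1 / z + (((2 : ℕ) * (1 : ℕ) : ℤ) : ℂ)) / ((2 : ℕ) * (2 : ℕ)) =
        (-1 / ((2 : ℕ) * z) + (1 : ℤ)) / (2 : ℕ) := by
      rw [← e₁, div_div]
    have e₄ : ((2 : ℕ) * z - (((1 : ℕ) : ℤ) : ℂ)) / (2 : ℕ) = z - 1 / 2 := by
      push_cast
      ring
    have e₅ : z + ((1 : ℕ) : ℂ) / (2 : ℕ) = z - 1 / 2 + (1 : ℤ) := by push_cast; ring
    have h₁' : eta (-1 / ((2 : ℕ) * z) + (1 : ℤ)) =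
        Real.sqrt (2 : ℕ) * zeta 24 ^ (1 : ℤ) * rootI z * eta ((2 : ℕ) * z) := by
      rw [h₁, hroot, add_zero, Int.cast_zero, sub_zero]
      ring
    have h₃' : eta ((-1 / ((2 : ℕ) * z) + (1 : ℤ)) / (2 : ℕ)) =
        Real.sqrt (2 : ℕ) * zeta 24 ^ (0 : ℤ) * rootI z * eta (z - 1 / 2 + (1 : ℤ)) := by
      rw [h₃, hroot, e₄, hshift]
      norm_num [etaExp]
      ring
    have hs : ((Real.sqrt (2 : ℕ) : ℝ) : ℂ) ≠ 0 := by
      exact_mod_cast (Real.sqrt_pos.mpr hpR).ne'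
    rw [Int.cast_zero, sub_zero] at h₄
    rw [hμ, w, e₁, e₃, h₁', h₃', h₄, CEq, thetaEq, if_pos rfl, epsEq, if_pos rfl, e₅,
      eta_quotient_mul (ε := Real.sqrt (2 : ℕ)) (zeta_ne_zero _) _ _ rfl (mul_ne_zero hr hr)]
    · rw [mul_comm (eta (z - 1 / 2 + (1 : ℤ))), ← pow_two, Int.cast_one, mul_one]
      rfl
    · rw [mul_one]
    · rw [mul_one]
      exact hs
  have hodd := h.prime₁.odd_of_ne_two h2
  obtain ⟨v, hv⟩ := hν
  have hdiv : (1 + (muEq p ν : ℤ) * ν) / p = v := by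
    rw [hv, Int.mul_ediv_cancel_left _ (by exact_mod_cast hp.ne')]
  rw [CEq, thetaEq, if_neg h2, epsEq, if_neg h2, hdiv]
  generalize (muEq p ν : ℤ) = μ at hv ⊢
  have h₁ := eta_inversion_int μ 0 hpz
  have h₃ := eta_inversion_odd_left (a := μ) (b := -v) (d := -ν) hodd
    (by linear_combination -hv) hpz
  have h₄ := eta_inversion_int (p * μ) 0 hz
  have hJ : (-(ν : ℤ)).gcd p = 1 := Int.isCoprime_iff_gcd_eq_one.mp
    ⟨μ, v, by linear_combination -hv⟩
  have e₁ : (-1 / z + ((p * μ : ℤ) : ℂ)) / p = -1 / (p * z) + μ := by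
    push_cast; field_simp
  have e₃ : (-1 / z + ((p * μ : ℤ) : ℂ)) / (p * p) = (-1 / (p * z) + μ) / p := by
    rw [← e₁, div_div]
  have e₄ : (p * z - ((-(ν : ℤ) : ℤ) : ℂ)) / p = z + ν / p := by
    push_cast
    field_simp
    ring
  rw [e₄] at h₃
  have hs : ((Real.sqrt p : ℝ) : ℂ) ≠ 0 := by exact_mod_cast (Real.sqrt_pos.mpr hpR).ne'
  have hJ2 : (jacobiSym (-ν) p : ℂ) * jacobiSym (-ν) p = 1 := by
    rw [← pow_two]
    exact_mod_cast jacobiSym.sq_one hJ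
  have hJ0 : (jacobiSym (-ν) p : ℂ) ≠ 0 := by exact_mod_cast jacobiSym.ne_zero hJ
  have h₁' : eta (-1 / (p * z) + μ) = Real.sqrt p * zeta 24 ^ μ * rootI z * eta (p * z) := by
    rw [h₁, hroot, add_zero, Int.cast_zero, sub_zero]
    ring
  have h₃' : eta ((-1 / (p * z) + μ) / p) = (jacobiSym (-ν) p * Real.sqrt p : ℂ) *
      zeta 24 ^ etaExp μ (-v) p (-ν) * rootI z * eta (z + ν / p) := by
    rw [h₃, hroot]
    ring
  rw [Int.cast_zero, sub_zero] at h₄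
  rw [w, e₁, e₃, h₁', h₃', h₄, eta_quotient_mul (ε := Real.sqrt p * jacobiSym (-ν) p)
    (zeta_ne_zero _) _ _ rfl (mul_ne_zero hr hr)]
  · rw [mul_comm (eta (z + ν / p)), ← pow_two, mul_pow, mul_pow _ _ e, mul_pow _ (_ / _) e,
      mul_pow _ (zeta 24 ^ _) e]
    congr 2
    rw [← zpow_natCast, ← zpow_natCast, ← zpow_mul, ← zpow_mul]
    apply zeta_zpow_congr
    -- Before multiplication by e, the two exponents differ by (p² - 1)v(μ + ν), using 1 + μν = pv.
    obtain ⟨t, ht⟩ := h.twentyfour_dvd_of_eq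
    refine ⟨t * v * (μ + ν), ?_⟩
    simp only [etaExp]
    linear_combination v * (μ + ν) * ht + e * p * μ * hv
  · linear_combination -(Real.sqrt p : ℂ) * Real.sqrt p * hJ2
  · rw [mul_one]
    exact mul_ne_zero hJ0 hs

end Admissible

/-! ### Residues -/

lemma mu_lt {q : ℕ} (hq : 0 < q) (t j : ℕ) : mu t q j < q :=
  haveI : NeZero q := ⟨hq.ne'⟩
  ZMod.val_lt _

lemma dvd_one_add_mu {t q j : ℕ} (hq : 0 < q) (ht : t.Coprime q) (hj : j.Coprime q) :
    (q : ℤ) ∣ 1 + (mu t q j : ℤ) * j * t := by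
  have : NeZero q := ⟨hq.ne'⟩
  rw [← ZMod.intCast_zmod_eq_zero_iff_dvd]
  have hu : IsUnit ((j * t : ℕ) : ZMod q) := (ZMod.isUnit_iff_coprime _ _).mpr (hj.mul_left ht)
  push_cast at hu ⊢
  rw [mu, ZMod.natCast_zmod_val, mul_assoc, neg_mul, ZMod.inv_mul_of_unit _ hu]
  ring

lemma coprime_of_dvd_one_add {q m : ℕ} {a : ℤ} (h : (q : ℤ) ∣ 1 + m * a) : m.Coprime q := by
  obtain ⟨v, hv⟩ := h
  exact Nat.isCoprime_iff_coprime.mp ⟨-a, v, by linear_combination -hv⟩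

lemma mu_coprime {t q j : ℕ} (hq : 0 < q) (ht : t.Coprime q) (hj : j.Coprime q) :
    (mu t q j).Coprime q :=
  coprime_of_dvd_one_add (a := j * t) (by rw [← mul_assoc]; exact dvd_one_add_mu hq ht hj)

/-- The congruence 1 + μjt ≡ 0 is symmetric in μ and j, so the map j ↦ μ is an involution on the
units. -/
lemma mu_mu {t q j : ℕ} (hq : 0 < q) (ht : t.Coprime q) (hj : j.Coprime q) (hlt : j < q) :
    mu t q (mu t q j) = j := by
  have h1 := dvd_one_add_mu hq ht hj
  have hc := mu_coprime hq ht hj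
  have h2 := dvd_one_add_mu hq ht hc
  have h3 : (q : ℤ) ∣ (mu t q j * t : ℕ) * ((mu t q (mu t q j) : ℤ) - j) := by
    have e : ((mu t q j * t : ℕ) : ℤ) * ((mu t q (mu t q j) : ℤ) - j) =
        1 + (mu t q (mu t q j) : ℤ) * mu t q j * t - (1 + (mu t q j : ℤ) * j * t) := by
      push_cast
      ring
    rw [e]
    exact dvd_sub h2 h1
  have h4 : IsCoprime (q : ℤ) ((mu t q j * t : ℕ) : ℤ) :=
    (Nat.isCoprime_iff_coprime.mpr (hc.mul_left ht)).symm
  have h5 := Nat.modEq_iff_dvd.mpr (h4.dvd_of_dvd_mul_left h3)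
  exact (Nat.ModEq.eq_of_lt_of_lt h5 hlt (mu_lt hq _ _)).symm

lemma sum_mu {M : Type*} [AddCommMonoid M] {t q : ℕ} (hq : 0 < q) (ht : t.Coprime q) (F : ℕ → M) :
    ∑ j ∈ (Finset.range q).filter (·.Coprime q), F (mu t q j) =
      ∑ j ∈ (Finset.range q).filter (·.Coprime q), F j := by
  have hmem : ∀ j ∈ (Finset.range q).filter (·.Coprime q),
      mu t q j ∈ (Finset.range q).filter (·.Coprime q) := by
    intro j hj
    rw [Finset.mem_filter, Finset.mem_range] at hj ⊢
    exact ⟨mu_lt hq _ _, mu_coprime hq ht hj.2⟩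
  have hinv : ∀ j ∈ (Finset.range q).filter (·.Coprime q), mu t q (mu t q j) = j := by
    intro j hj
    rw [Finset.mem_filter, Finset.mem_range] at hj
    exact mu_mu hq ht hj.2 hj.1
  exact Finset.sum_nbij' (mu t q) (mu t q) hmem hmem hinv hinv fun _ _ => rfl

lemma filter_coprime_prime {q : ℕ} (hq : q.Prime) :
    (Finset.range q).filter (·.Coprime q) = Finset.Ico 1 q := by
  ext j
  rw [Finset.mem_filter, Finset.mem_range, Finset.mem_Ico]
  constructor
  · rintro ⟨h1, h2⟩
    refine ⟨Nat.pos_of_ne_zero ?_, h1⟩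
    rintro rfl
    rw [Nat.coprime_zero_left] at h2
    exact hq.one_lt.ne' h2
  · rintro ⟨h1, h2⟩
    exact ⟨h2, (Nat.coprime_of_lt_prime (Nat.pos_iff_ne_zero.mp h1) h2 hq).symm⟩

lemma sum_Ico_mu {M : Type*} [AddCommMonoid M] {t q : ℕ} (hq : q.Prime) (ht : t.Coprime q)
    (F : ℕ → M) : ∑ j ∈ Finset.Ico 1 q, F (mu t q j) = ∑ j ∈ Finset.Ico 1 q, F j := by
  have := sum_mu hq.pos ht F
  rwa [filter_coprime_prime hq] at this

lemma muEq_eq_mu (p j : ℕ) : muEq p j = mu 1 p j := by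
  rw [muEq, mu, Nat.cast_one, mul_one]

/-- The classes are separated by their behaviour under inversion: 0 is paired with B', units with
units, and nonzero multiples of a prime with the C'. -/
lemma sum_range_mul_of_ne {M : Type*} [AddCommMonoid M] {p q : ℕ} (hp : p.Prime) (hq : q.Prime)
    (hne : p ≠ q) (F : ℕ → M) :
    ∑ ν ∈ Finset.range (p * q), F ν =
      F 0 + ∑ ν ∈ (Finset.range (p * q)).filter (·.Coprime (p * q)), F ν +
        ∑ j ∈ Finset.Ico 1 p, F (q * j) + ∑ j ∈ Finset.Ico 1 q, F (p * j) := by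
  have hcop := (Nat.coprime_primes hp hq).mpr hne
  have key : (Finset.range (p * q)).filter (¬ ·.Coprime (p * q)) =
      insert 0 ((Finset.Ico 1 p).image (q * ·) ∪ (Finset.Ico 1 q).image (p * ·)) := by
    ext ν
    simp only [Finset.mem_filter, Finset.mem_range, Finset.mem_insert, Finset.mem_union,
      Finset.mem_image, Finset.mem_Ico, Nat.coprime_mul_iff_right, not_and_or]
    rw [Nat.coprime_comm (m := p), Nat.coprime_comm (m := q), hp.coprime_iff_not_dvd, hq.coprime_iff_not_dvd, not_not,
      not_not]
    constructor
    · rintro ⟨hlt, ⟨j, rfl⟩ | ⟨j, rfl⟩⟩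
      · rcases Nat.eq_zero_or_pos j with rfl | hj
        · simp
        · exact Or.inr (Or.inr ⟨j, ⟨hj, lt_of_mul_lt_mul_left hlt (Nat.zero_le p)⟩, rfl⟩)
      · rcases Nat.eq_zero_or_pos j with rfl | hj
        · simp
        · rw [mul_comm p] at hlt
          exact Or.inr (Or.inl ⟨j, ⟨hj, lt_of_mul_lt_mul_left hlt (Nat.zero_le q)⟩, rfl⟩)
    · rintro (rfl | ⟨j, ⟨_, hj⟩, rfl⟩ | ⟨j, ⟨_, hj⟩, rfl⟩)
      · exact ⟨Nat.mul_pos hp.pos hq.pos, Or.inl (dvd_zero _)⟩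
      · exact ⟨by rw [mul_comm]; exact Nat.mul_lt_mul_of_pos_right hj hq.pos, Or.inr ⟨j, rfl⟩⟩
      · exact ⟨Nat.mul_lt_mul_of_pos_left hj hp.pos, Or.inl ⟨j, rfl⟩⟩
  have hdis : Disjoint ((Finset.Ico 1 p).image (q * ·)) ((Finset.Ico 1 q).image (p * ·)) := by
    rw [Finset.disjoint_left]
    intro x hx hy
    rw [Finset.mem_image] at hx hy
    obtain ⟨a, ha, rfl⟩ := hx
    obtain ⟨b, hb, hab⟩ := hy
    rw [Finset.mem_Ico] at ha
    have : p ∣ a := hcop.dvd_of_dvd_mul_left ⟨b, hab.symm⟩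
    exact absurd (Nat.le_of_dvd ha.1 this) (not_le.mpr ha.2)
  have h0 : 0 ∉ (Finset.Ico 1 p).image (q * ·) ∪ (Finset.Ico 1 q).image (p * ·) := by
    simp only [Finset.mem_union, Finset.mem_image, Finset.mem_Ico, not_or, not_exists, not_and]
    exact ⟨fun x hx => (Nat.mul_pos hq.pos hx.1).ne', fun x hx => (Nat.mul_pos hp.pos hx.1).ne'⟩
  rw [← Finset.sum_filter_add_sum_filter_not (Finset.range (p * q)) (·.Coprime (p * q)), key,
    Finset.sum_insert h0, Finset.sum_union hdis,
    Finset.sum_image fun a _ b _ hab => Nat.eq_of_mul_eq_mul_left hq.pos hab,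
    Finset.sum_image fun a _ b _ hab => Nat.eq_of_mul_eq_mul_left hp.pos hab]
  abel

lemma sum_range_mul_self {M : Type*} [AddCommMonoid M] {p : ℕ} (hp : p.Prime) (F : ℕ → M) :
    ∑ ν ∈ Finset.range (p * p), F ν =
      F 0 + ∑ ν ∈ (Finset.range (p * p)).filter (·.Coprime (p * p)), F ν +
        ∑ j ∈ Finset.Ico 1 p, F (p * j) := by
  have key : (Finset.range (p * p)).filter (¬ ·.Coprime (p * p)) =
      insert 0 ((Finset.Ico 1 p).image (p * ·)) := by
    ext ν
    simp only [Finset.mem_filter, Finset.mem_range, Finset.mem_insert,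
      Finset.mem_image, Finset.mem_Ico, Nat.coprime_mul_iff_right, and_self]
    rw [Nat.coprime_comm, hp.coprime_iff_not_dvd, not_not]
    constructor
    · rintro ⟨hlt, j, rfl⟩
      rcases Nat.eq_zero_or_pos j with rfl | hj
      · simp
      · exact Or.inr ⟨j, ⟨hj, lt_of_mul_lt_mul_left hlt (Nat.zero_le p)⟩, rfl⟩
    · rintro (rfl | ⟨j, ⟨_, hj⟩, rfl⟩)
      · exact ⟨Nat.mul_pos hp.pos hp.pos, dvd_zero _⟩
      · exact ⟨Nat.mul_lt_mul_of_pos_left hj hp.pos, ⟨j, rfl⟩⟩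
  have h0 : 0 ∉ (Finset.Ico 1 p).image (p * ·) := by
    simp only [Finset.mem_image, Finset.mem_Ico, not_exists, not_and]
    exact fun x hx => (Nat.mul_pos hp.pos hx.1).ne'
  rw [← Finset.sum_filter_add_sum_filter_not (Finset.range (p * p)) (·.Coprime (p * p)), key,
    Finset.sum_insert h0,
    Finset.sum_image fun a _ b _ hab => Nat.eq_of_mul_eq_mul_left hp.pos hab]
  abel

lemma sum_range_shift {M : Type*} [AddCommGroup M] {f : ℤ → M} {N : ℕ}
    (hf : Function.Periodic f (N : ℤ)) :
    ∑ ν ∈ Finset.range N, f ((ν : ℤ) + 1) = ∑ ν ∈ Finset.range N, f ν := by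
  have h1 := Finset.sum_range_succ (fun ν : ℕ => f ν) N
  rw [Finset.sum_range_succ'] at h1
  have h2 : f (N : ℤ) = f 0 := by simpa using hf 0
  push_cast at h1
  rw [h2] at h1
  exact add_right_cancel h1

/-! ### The power sums -/

namespace Admissible

variable {p q e δ : ℕ}

lemma twA_neg_one_div_of_coprime (h : Admissible p q e δ) {ν : ℕ} (hν : ν.Coprime (p * q)) {z : ℂ}
    (hz : 0 < z.im) :
    twA p q e δ ν (-1 / z) = chi p q e ^ alpha0 δ * twA p q e δ (mu 1 (p * q) ν) z := by
  have hN := Nat.mul_pos h.prime₁.pos h.prime₂.pos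
  obtain ⟨K, hK⟩ := dvd_one_add_mu hN (Nat.coprime_one_left _) hν
  have hlt := mu_lt hN 1 ν
  generalize mu 1 (p * q) ν = m at hK hlt ⊢
  -- An odd representative of -m modulo N: N - m, or else 2N - m. In the second case N is odd, since
  -- for even N the unit m is odd and N - m would already do.
  obtain ⟨r, d, hd, hdr⟩ : ∃ r : ℤ, ∃ d : ℕ, Odd d ∧ (d : ℤ) = r * ((p * q : ℕ) : ℤ) - m := by
    rcases Nat.even_or_odd (p * q - m) with he | ho
    · have hNodd : Odd (p * q) := by
        rw [← Nat.not_even_iff_odd]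
        intro hNe
        have hme : Even m := (Nat.even_sub hlt.le).mp he |>.mp hNe
        obtain ⟨x, hx⟩ := hNe
        obtain ⟨y, hy⟩ := hme
        rw [hx, hy] at hK
        push_cast at hK
        have : 2 * (x * K - y * ν) = 1 := by linear_combination -hK
        omega
      refine ⟨2, p * q + (p * q - m), hNodd.add_even he, ?_⟩
      push_cast [hlt.le]
      ring
    · refine ⟨1, p * q - m, ho, ?_⟩
      push_cast [hlt.le]
      ring
  have hper : twA p q e δ (-(d : ℤ) + r * ((p * q : ℕ) : ℤ)) z = twA p q e δ (-d) z :=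
    (h.twA_periodic z).int_mul r (-d)
  rw [h.twA_neg_one_div_of_unit (ν := ν) (K := K - r * ν) hd ?_ hz, ← hper]
  · congr 2
    rw [hdr]
    ring
  · rw [hdr]
    push_cast at hK ⊢
    linear_combination -hK

lemma sum_twA_add_one (h : Admissible p q e δ) (k : ℤ) (z : ℂ) :
    ∑ ν ∈ Finset.range (p * q), twA p q e δ ν (z + 1) ^ k =
      chi p q e ^ k * ∑ ν ∈ Finset.range (p * q), twA p q e δ ν z ^ k := by
  have hper : Function.Periodic (fun n : ℤ => twA p q e δ n z ^ k) ((p * q : ℕ) : ℤ) := fun n => by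
    have := h.twA_periodic z n
    simp only at this ⊢
    rw [this]
  rw [← sum_range_shift hper, Finset.mul_sum]
  exact Finset.sum_congr rfl fun ν _ => by rw [twA_add_one, mul_zpow]

lemma sum_twC_add_one (h : Admissible p q e δ) (k : ℤ) (z : ℂ) :
    ∑ ν ∈ Finset.range q, twC p q e ν (z + 1) ^ k =
      chi p q e ^ k * ∑ ν ∈ Finset.range q, twC p q e ν z ^ k := by
  have hper : Function.Periodic (fun n : ℤ => twC p q e n z ^ k) (q : ℤ) := fun n => by
    have := h.twC_periodic z n
    simp only at this ⊢
    rw [this]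
  rw [← sum_range_shift hper, Finset.mul_sum]
  exact Finset.sum_congr rfl fun ν _ => by rw [twC_add_one, mul_zpow]

lemma sum_twA_coprime_neg_one_div (h : Admissible p q e δ) (k : ℤ) {z : ℂ} (hz : 0 < z.im) :
    ∑ ν ∈ (Finset.range (p * q)).filter (·.Coprime (p * q)), twA p q e δ (ν : ℕ) (-1 / z) ^ k =
      (chi p q e ^ alpha0 δ) ^ k *
        ∑ ν ∈ (Finset.range (p * q)).filter (·.Coprime (p * q)), twA p q e δ (ν : ℕ) z ^ k := by
  rw [← sum_mu (Nat.mul_pos h.prime₁.pos h.prime₂.pos) (Nat.coprime_one_left _)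
    (fun ν : ℕ => twA p q e δ ν z ^ k), Finset.mul_sum]
  refine Finset.sum_congr rfl fun ν hν => ?_
  rw [h.twA_neg_one_div_of_coprime (Finset.mem_filter.mp hν).2 hz, mul_zpow]

lemma coprime_of_mem_Ico {q j : ℕ} (hq : q.Prime) (hj : j ∈ Finset.Ico 1 q) : j.Coprime q := by
  rw [← filter_coprime_prime hq] at hj
  exact (Finset.mem_filter.mp hj).2

lemma sum_twA_mul_neg_one_div (h : Admissible p q e δ) (hne : p ≠ q) (k : ℤ) {z : ℂ}
    (hz : 0 < z.im) :
    ∑ j ∈ Finset.Ico 1 q, twA p q e δ (p * j : ℕ) (-1 / z) ^ k =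
      (chi p q e ^ alpha0 δ) ^ k * ∑ j ∈ Finset.Ico 1 q, twC p q e (j : ℕ) z ^ k := by
  have hcop := (Nat.coprime_primes h.prime₁ h.prime₂).mpr hne
  rw [← sum_Ico_mu h.prime₂ hcop (fun j : ℕ => twC p q e j z ^ k), Finset.mul_sum]
  refine Finset.sum_congr rfl fun j hj => ?_
  rw [Nat.cast_mul, h.twA_mul_neg_one_div hne
    (dvd_one_add_mu h.prime₂.pos hcop (coprime_of_mem_Ico h.prime₂ hj)) hz, mul_zpow]

lemma sum_twA_eq_neg_one_div (h : Admissible p p e δ) (k : ℤ) {z : ℂ} (hz : 0 < z.im) :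
    ∑ j ∈ Finset.Ico 1 p, twA p p e δ (p * j : ℕ) (-1 / z) ^ k =
      (chi p p e ^ alpha0 δ) ^ k * ∑ j ∈ Finset.Ico 1 p, CEq' p e j z ^ k := by
  -- Reindexing is done on the A' side because C'_ν is labelled by ν and its partner is A'_{pμ}.
  rw [← sum_Ico_mu h.prime₁ (Nat.coprime_one_left _)
    (fun j : ℕ => twA p p e δ (p * j : ℕ) (-1 / z) ^ k), Finset.mul_sum]
  refine Finset.sum_congr rfl fun j hj => ?_
  have hdvd := dvd_one_add_mu h.prime₁.pos (Nat.coprime_one_left _) (coprime_of_mem_Ico h.prime₁ hj)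
  rw [Nat.cast_one, mul_one] at hdvd
  rw [← muEq_eq_mu] at hdvd ⊢
  rw [Nat.cast_mul, h.twA_eq_neg_one_div hdvd (Finset.mem_Ico.mp hj).2 hz, mul_zpow]

/-- Interchanging the two sides of an inversion law. -/
lemma inversion_symm (h : Admissible p q e δ) {F G : ℂ → ℂ} (k : ℤ)
    (H : ∀ z : ℂ, 0 < z.im → F (-1 / z) = (chi p q e ^ alpha0 δ) ^ k * G z) {z : ℂ}
    (hz : 0 < z.im) : G (-1 / z) = (chi p q e ^ alpha0 δ) ^ k * F z := by
  have hz0 : z ≠ 0 := fun h => by simp [h] at hz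
  have h1 := H _ (neg_one_div_im_pos hz)
  rw [show -1 / (-1 / z) = z by field_simp] at h1
  rw [h1, ← mul_assoc, ← mul_zpow, h.chi_zpow_alpha0_mul_self, one_zpow, one_mul]

lemma powerSum_of_ne (h : Admissible p q e δ) (hne : p ≠ q) (u v k : ℤ) (z : ℂ) :
    powerSum p q e u v k z = B' p q e z ^ k + ∑ ν ∈ Finset.range (p * q), twA p q e δ ν z ^ k +
      (∑ ν ∈ Finset.range p, twC q p e ν z ^ k + ∑ ν ∈ Finset.range q, twC p q e ν z ^ k) := by
  have hδ : s p q / e = δ := by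
    rw [← h.mul_eq, Nat.mul_div_cancel_left _ h.e_pos]
  rw [powerSum, if_neg hne]
  simp only [A'_eq_twA, C₁'_eq_twC, C₂'_eq_twC, hδ]

lemma powerSum_of_eq (h : Admissible p p e δ) (u v k : ℤ) (z : ℂ) :
    powerSum p p e u v k z = B' p p e z ^ k + ∑ ν ∈ Finset.range (p * p), twA p p e δ ν z ^ k +
      ∑ ν ∈ Finset.Ico 1 p, CEq' p e ν z ^ k := by
  have hδ : s p p / e = δ := by
    rw [← h.mul_eq, Nat.mul_div_cancel_left _ h.e_pos]
  rw [powerSum, if_pos rfl]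
  simp only [A'_eq_twA, hδ]

theorem powerSum_add_one (h : Admissible p q e δ) (u v k : ℤ) (z : ℂ) :
    powerSum p q e u v k (z + 1) = chi p q e ^ k * powerSum p q e u v k z := by
  by_cases hne : p = q
  · subst hne
    rw [h.powerSum_of_eq, h.powerSum_of_eq, h.B'_add_one, h.sum_twA_add_one, mul_zpow]
    have : ∑ ν ∈ Finset.Ico 1 p, CEq' p e ν (z + 1) ^ k =
        chi p p e ^ k * ∑ ν ∈ Finset.Ico 1 p, CEq' p e ν z ^ k := by
      rw [Finset.mul_sum]
      exact Finset.sum_congr rfl fun ν _ => by rw [h.CEq'_add_one, mul_zpow]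
    rw [this]
    ring
  · have h' := h.symm.sum_twC_add_one k z
    rw [chi_comm q p] at h'
    rw [h.powerSum_of_ne hne, h.powerSum_of_ne hne, h.B'_add_one, h.sum_twA_add_one,
      h.sum_twC_add_one, h', mul_zpow]
    ring

theorem powerSum_neg_one_div (h : Admissible p q e δ) (u v k : ℤ) {z : ℂ} (hz : 0 < z.im) :
    powerSum p q e u v k (-1 / z) = chi p q e ^ (alpha0 δ * k) * powerSum p q e u v k z := by
  rw [zpow_mul]
  by_cases hne : p = q
  · subst hne
    have hC := h.inversion_symm (F := fun z => ∑ j ∈ Finset.Ico 1 p, twA p p e δ (p * j : ℕ) z ^ k)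
      (G := fun z => ∑ j ∈ Finset.Ico 1 p, CEq' p e j z ^ k) k (fun z hz => h.sum_twA_eq_neg_one_div k hz) hz
    rw [h.powerSum_of_eq, h.powerSum_of_eq, sum_range_mul_self h.prime₁,
      sum_range_mul_self h.prime₁, h.B'_neg_one_div hz, Nat.cast_zero, h.twA_zero_neg_one_div hz,
      h.sum_twA_coprime_neg_one_div k hz, h.sum_twA_eq_neg_one_div k hz, hC, mul_zpow, mul_zpow]
    ring
  · have hA₁ : ∀ z : ℂ, 0 < z.im → ∑ j ∈ Finset.Ico 1 p, twA p q e δ (q * j : ℕ) (-1 / z) ^ k =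
        (chi p q e ^ alpha0 δ) ^ k * ∑ j ∈ Finset.Ico 1 p, twC q p e (j : ℕ) z ^ k := by
      intro z hz
      have := h.symm.sum_twA_mul_neg_one_div (Ne.symm hne) k hz
      rw [chi_comm q p] at this
      rw [← this]
      exact Finset.sum_congr rfl fun j _ => by rw [twA_comm]
    have hA₂ := fun (z : ℂ) (hz : 0 < z.im) => h.sum_twA_mul_neg_one_div hne k hz
    have hC₁ := h.inversion_symm
      (F := fun z => ∑ j ∈ Finset.Ico 1 p, twA p q e δ (q * j : ℕ) z ^ k)
      (G := fun z => ∑ j ∈ Finset.Ico 1 p, twC q p e (j : ℕ) z ^ k) k hA₁ hz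
    have hC₂ := h.inversion_symm
      (F := fun z => ∑ j ∈ Finset.Ico 1 q, twA p q e δ (p * j : ℕ) z ^ k)
      (G := fun z => ∑ j ∈ Finset.Ico 1 q, twC p q e (j : ℕ) z ^ k) k hA₂ hz
    have h₁ := h.symm.twC_zero_neg_one_div (Ne.symm hne) hz
    rw [chi_comm q p] at h₁
    have hsplit : ∀ (n : ℕ), 0 < n → ∀ F : ℕ → ℂ,
        ∑ j ∈ Finset.range n, F j = F 0 + ∑ j ∈ Finset.Ico 1 n, F j := by
      intro n hn F
      rw [Finset.range_eq_Ico, Finset.sum_eq_sum_Ico_succ_bot hn]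
    rw [h.powerSum_of_ne hne, h.powerSum_of_ne hne, sum_range_mul_of_ne h.prime₁ h.prime₂ hne,
      sum_range_mul_of_ne h.prime₁ h.prime₂ hne, hsplit p h.prime₁.pos, hsplit q h.prime₂.pos,
      hsplit p h.prime₁.pos, hsplit q h.prime₂.pos, h.B'_neg_one_div hz, Nat.cast_zero,
      h.twA_zero_neg_one_div hz, h.sum_twA_coprime_neg_one_div k hz, hA₁ z hz, hA₂ z hz, hC₁, hC₂,
      h₁, h.twC_zero_neg_one_div hne hz]
    simp only [mul_zpow]
    ring

end Admissible

end DoubleEta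

/-! ### The main theorem -/

theorem mainTheorem2 (p₁ p₂ : ℕ) (hp₁ : p₁.Prime) (hp₂ : p₂.Prime) (e δ : ℕ)
    (he : e ∣ DoubleEta.s p₁ p₂) (hes : e ≠ DoubleEta.s p₁ p₂)
    (hδ : δ = DoubleEta.s p₁ p₂ / e) (hN : p₁ * p₂ ≡ 1 [MOD δ])
    (u v : ℤ) (huv : p₁ ≠ p₂ → u * p₁ + v * p₂ = 1) :
    (δ = 2 ∨ δ = 3 ∨ δ = 6) ∧
    IsPrimitiveRoot (DoubleEta.chi p₁ p₂ e) δ ∧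
    DoubleEta.chi p₁ p₂ e ^ DoubleEta.alpha0 δ = (-1) ^ (δ + 1) ∧
    DoubleEta.chi p₁ p₂ e ^ (-DoubleEta.alpha0 δ) = (-1) ^ (δ + 1) ∧
    DoubleEta.chi p₁ p₂ e ^ (-3 : ℤ) = (-1) ^ (δ + 1) ∧
    ∀ (k : ℤ) (z : UpperHalfPlane),
      DoubleEta.powerSum p₁ p₂ e u v k ((ModularGroup.T • z : UpperHalfPlane) : ℂ) =
        DoubleEta.chi p₁ p₂ e ^ k * DoubleEta.powerSum p₁ p₂ e u v k (z : ℂ) ∧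
      DoubleEta.powerSum p₁ p₂ e u v k ((ModularGroup.S • z : UpperHalfPlane) : ℂ) =
        DoubleEta.chi p₁ p₂ e ^ (DoubleEta.alpha0 δ * k) *
          DoubleEta.powerSum p₁ p₂ e u v k (z : ℂ) := by
  have hmul : e * δ = DoubleEta.s p₁ p₂ := by rw [hδ, Nat.mul_div_cancel' he]
  have h : DoubleEta.Admissible p₁ p₂ e δ :=
    ⟨hp₁, hp₂, hmul, fun h1 => hes (by rw [← hmul, h1, mul_one]), hN⟩
  refine ⟨h.delta_cases, h.chi_isPrimitiveRoot, h.chi_zpow_alpha0, h.chi_zpow_neg_alpha0,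
    h.chi_zpow_neg_three, fun k z => ⟨?_, ?_⟩⟩
  · have hT : ((ModularGroup.T • z : UpperHalfPlane) : ℂ) = z + 1 := by
      rw [UpperHalfPlane.modular_T_smul, UpperHalfPlane.coe_vadd, Complex.ofReal_one, add_comm]
    rw [hT, h.powerSum_add_one]
  · have hS : ((ModularGroup.S • z : UpperHalfPlane) : ℂ) = -1 / z := by
      rw [UpperHalfPlane.modular_S_smul, UpperHalfPlane.coe_mk, inv_neg, neg_div, one_div]
    rw [hS, h.powerSum_neg_one_div u v k z.im_pos]
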